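/- For finite graphs $G,H$, the Ramsey number $R(G,H)$ is the smallest $N$ such that every colouring of the edges of $K_N$ with red and blue contains a red copy of $G$ or a blue copy of $H$ (copies need not be induced). The $k$th power $F^k$ of a graph $F$ has the same vertex set as $F$, and two distinct vertices are adjacent in $F^k$ when their distance in $F$ is at most $k$. Let $P_n$ and $C_n$ denote the path and the cycle on $n$ vertices, and let $\chi$ denote the chromatic number. **Theorem.** For every fixed integer $k\ge 2$, as $n\to\infty$, $$R(P_n^k,P_n^k)\le\Bigl(2k+2+\frac{2}{k+1}\Bigr)n+o(n)$$ and $$R(C_n^k,C_n^k)\le\Bigl(2\chi(C_n^k)+\frac{2}{\chi(C_n^k)}\Bigr)n+o(n),$$ where the $o(n)$ terms may depend on $k$. -/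

import Mathlib

open Filter Asymptotics

/-- The `k`-th power of a graph `F`: same vertices, and two distinct vertices are adjacent when
their distance in `F` is at most `k` (`edist` is infinite between different components). -/
def graphPower {V : Type*} (F : SimpleGraph V) (k : ℕ) : SimpleGraph V where
  Adj u v := u ≠ v ∧ F.edist u v ≤ (k : ℕ∞)
  symm := ⟨fun u v h => ⟨h.1.symm, by rw [SimpleGraph.edist_comm]; exact h.2⟩⟩
  loopless := ⟨fun _ h => h.1 rfl⟩

/-- `P_n^k`, the `k`-th power of the path on `n` vertices. -/
def pathPower (n k : ℕ) : SimpleGraph (Fin n) := graphPower (SimpleGraph.pathGraph n) k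

/-- `C_n^k`, the `k`-th power of the cycle on `n` vertices. -/
def cyclePower (n k : ℕ) : SimpleGraph (Fin n) := graphPower (SimpleGraph.cycleGraph n) k

/-- `IsRamsey G H N`: every red/blue colouring of the edges of `K_N` contains a red copy of `G` or
a blue copy of `H`. The colouring is given by its graph `C` of red edges; the blue edges form the
complement of `C`. A copy is a not necessarily induced subgraph. -/
def IsRamsey {V W : Type*} (G : SimpleGraph V) (H : SimpleGraph W) (N : ℕ) : Prop :=
  ∀ C : SimpleGraph (Fin N), G.IsContained C ∨ H.IsContained Cᶜ

/-- The Ramsey number `R(G, H)`: the smallest `N` such that every red/blue colouring of the edges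
of `K_N` contains a red copy of `G` or a blue copy of `H`. -/
noncomputable def ramseyNumber {V W : Type*} (G : SimpleGraph V) (H : SimpleGraph W) : ℕ :=
  sInf {N | IsRamsey G H N}

theorem exists_clique_or_clique_compl (a b : ℕ) :
    ∃ N : ℕ, ∀ (V : Type) (C : SimpleGraph V) (s : Finset V), N ≤ s.card →
      (∃ t ⊆ s, C.IsNClique a t) ∨ (∃ t ⊆ s, Cᶜ.IsNClique b t) := by
  classical
  induction a generalizing b with
  | zero => exact ⟨0, fun V C s _ => Or.inl ⟨∅, by simp, by simp [SimpleGraph.isNClique_iff]⟩⟩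
  | succ a iha =>
    induction b with
    | zero => exact ⟨0, fun V C s _ => Or.inr ⟨∅, by simp, by simp [SimpleGraph.isNClique_iff]⟩⟩
    | succ b ihb =>
      obtain ⟨N₁, h₁⟩ := iha (b + 1)
      obtain ⟨N₂, h₂⟩ := ihb
      refine ⟨N₁ + N₂ + 1, fun V C s hs => ?_⟩
      obtain ⟨v, hv⟩ : s.Nonempty := Finset.card_pos.1 (by omega)
      have hc := Finset.card_erase_of_mem hv
      have hf := Finset.card_filter_add_card_filter_not (s := s.erase v) (fun w => C.Adj v w)
      have hsub : s.erase v ⊆ s := Finset.erase_subset _ _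
      rcases le_or_gt N₁ ((s.erase v).filter fun w => C.Adj v w).card with h | h
      · rcases h₁ V C _ h with ⟨t, ht, hq⟩ | ⟨t, ht, hq⟩
        · refine Or.inl ⟨insert v t, ?_, hq.insert fun w hw => (Finset.mem_filter.1 (ht hw)).2⟩
          exact Finset.insert_subset hv (ht.trans ((Finset.filter_subset _ _).trans hsub))
        · exact Or.inr ⟨t, ht.trans ((Finset.filter_subset _ _).trans hsub), hq⟩
      · rcases h₂ V C ((s.erase v).filter fun w => ¬ C.Adj v w) (by omega) with
          ⟨t, ht, hq⟩ | ⟨t, ht, hq⟩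
        · exact Or.inl ⟨t, ht.trans ((Finset.filter_subset _ _).trans hsub), hq⟩
        · refine Or.inr ⟨insert v t, ?_, hq.insert fun w hw => ?_⟩
          · exact Finset.insert_subset hv (ht.trans ((Finset.filter_subset _ _).trans hsub))
          · have hw' := Finset.mem_filter.1 (ht hw)
            rw [SimpleGraph.compl_adj]
            exact ⟨(Finset.ne_of_mem_erase hw'.1).symm, hw'.2⟩

theorem isContained_of_isNClique {V W : Type*} [Fintype V] (G : SimpleGraph V) (C : SimpleGraph W)
    {t : Finset W} (h : C.IsNClique (Fintype.card V) t) : G.IsContained C := by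
  have e : V ≃ t := Fintype.equivOfCardEq (by simp [h.card_eq])
  refine ⟨⟨⟨fun v => (e v : W), fun {u v} huv => ?_⟩, ?_⟩⟩
  · exact h.isClique (e u).2 (e v).2 fun hq => huv.ne (e.injective (Subtype.ext hq))
  · exact fun u v huv => e.injective (Subtype.ext huv)

/-- Ramsey's theorem: for finite graphs the minimum that defines `ramseyNumber` is attained. -/
theorem isLeast_ramseyNumber {V W : Type*} [Finite V] [Finite W]
    (G : SimpleGraph V) (H : SimpleGraph W) :
    IsLeast {N | IsRamsey G H N} (ramseyNumber G H) := by
  have := Fintype.ofFinite V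
  have := Fintype.ofFinite W
  obtain ⟨N, hN⟩ := exists_clique_or_clique_compl (Fintype.card V) (Fintype.card W)
  have hne : {N | IsRamsey G H N}.Nonempty := by
    refine ⟨N, fun C => ?_⟩
    rcases hN _ C Finset.univ (by simp) with ⟨t, -, ht⟩ | ⟨t, -, ht⟩
    · exact Or.inl (isContained_of_isNClique G C ht)
    · exact Or.inr (isContained_of_isNClique H _ ht)
  exact ⟨Nat.sInf_mem hne, fun M hM => Nat.sInf_le hM⟩

/-- The chromatic number `χ(G)` of a finite graph, as a natural number. -/
noncomputable def chi {V : Type*} [Finite V] (G : SimpleGraph V) : ℕ := G.chromaticNumber.toNat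

theorem coe_chi {V : Type*} [Finite V] (G : SimpleGraph V) : (chi G : ℕ∞) = G.chromaticNumber := by
  have := Fintype.ofFinite V
  exact ENat.natCast_toNat (SimpleGraph.chromaticNumber_ne_top_iff_exists.2
    ⟨_, G.colorable_of_fintype⟩)

/-! ### Adjacency and cliques in powers of paths and cycles. -/

section PowerFacts

/-! It suffices to treat cycles with constant `k + 1` in place of `χ`: the path power lies in the
cycle power, `χ(C_n^k) ≥ k + 1` for `n ≥ k + 1`, and `x + 1/x` increases for `x ≥ 1`. For large `n`
the bound even holds without error term.

By Ramsey's theorem all but boundedly many vertices are covered by disjoint monochromatic cliques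
(blocks) of a fixed size `M`. Keep the majority colour, say red; these blocks cover about `(k + 1 +
1/(k+1)) n` vertices. Join two blocks when the red density between them is at least `η`, and split
the blocks into classes without sparse cuts, with few joined pairs between classes
(`exists_cutDense_partition`).

If some class covers `n` vertices, there is a red `C_n^k` (`cyclePower_isContained_of_cutDense`).
Such a class stays connected with bounded diameter after deleting few blocks, and each joined pair
contains a red `K_{k,k}` avoiding a bounded set. Hence a short closed power sequence can be threaded
through all its blocks with `2k` consecutive terms in each; unused block vertices are then inserted
in the middle of these runs until the length is exactly `n`.

Otherwise every class is small. The classes merge into `k + 2` groups, each covering slightly more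
than `n/(k+2)` vertices: `k + 1` of them use at most about `n` vertices apiece, and the rest forms
the last. Almost all edges between groups are blue, so a nearly balanced `(k+2)`-colouring of
`C_n^k` embeds greedily in blue (`cyclePower_isContained_of_few_missing`). The gap between `1/(k+1)`
and `1/(k+2)` pays for all losses. -/

theorem cycleGraph_val_of_adj {n : ℕ} {u v : Fin n} (h : (SimpleGraph.cycleGraph n).Adj u v) :
    (u : ℕ) + 1 = v ∨ (v : ℕ) + 1 = u ∨ (u : ℕ) + 1 = v + n ∨ (v : ℕ) + 1 = u + n := by
  have hsub : ∀ a b : Fin n, (a - b).val = 1 → (b : ℕ) + 1 = a ∨ (b : ℕ) + 1 = a + n := by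
    intro a b hab
    rcases le_or_gt b a with hle | hlt
    · rw [Fin.sub_val_of_le hle] at hab
      have : (b : ℕ) ≤ a := hle
      omega
    · rw [Fin.coe_sub_iff_lt.2 hlt] at hab
      have : (a : ℕ) < b := hlt
      omega
  rcases SimpleGraph.cycleGraph_adj'.1 h with h | h
  · have := hsub _ _ h; omega
  · have := hsub _ _ h; omega

theorem cycleGraph_val_of_walk {n : ℕ} {u v : Fin n} (w : (SimpleGraph.cycleGraph n).Walk u v) :
    ((v : ℕ) ≤ u + w.length ∧ (u : ℕ) ≤ v + w.length) ∨
      (u : ℕ) + n ≤ v + w.length ∨ (v : ℕ) + n ≤ u + w.length := by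
  induction w with
  | nil => simp
  | @cons a b c h p ih =>
    have h1 := cycleGraph_val_of_adj h
    rw [SimpleGraph.Walk.length_cons]
    have := a.2
    have := b.2
    have := c.2
    omega

theorem cyclePower_val_of_adj {n k : ℕ} {u v : Fin n} (h : (cyclePower n k).Adj u v)
    (_ : (u : ℕ) < v) : (v : ℕ) ≤ u + k ∨ (u : ℕ) + n ≤ v + k := by
  obtain ⟨-, hd⟩ := h
  have hne : (SimpleGraph.cycleGraph n).edist u v ≠ ⊤ :=
    ne_top_of_le_ne_top (ENat.natCast_ne_top k) hd
  obtain ⟨w, hw⟩ := SimpleGraph.exists_walk_of_edist_ne_top hne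
  rw [← hw] at hd
  have hd' : w.length ≤ k := by exact_mod_cast hd
  have := cycleGraph_val_of_walk w
  have := u.2
  have := v.2
  omega

theorem pathPower_le_cyclePower (n k : ℕ) : pathPower n k ≤ cyclePower n k := by
  intro u v h
  exact ⟨h.1, (SimpleGraph.edist_anti SimpleGraph.pathGraph_le_cycleGraph).trans h.2⟩

theorem edist_pathGraph_le {n : ℕ} (d : ℕ) : ∀ u v : Fin n, (v : ℕ) = u + d →
    (SimpleGraph.pathGraph n).edist u v ≤ d := by
  induction d with
  | zero =>
    intro u v h
    have : u = v := Fin.ext (by omega)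
    simp [this]
  | succ d ih =>
    intro u v h
    have hv := v.2
    have h1 := ih u ⟨u + d, by omega⟩ rfl
    have h2 : (SimpleGraph.pathGraph n).edist ⟨u + d, by omega⟩ v ≤ 1 := by
      refine SimpleGraph.edist_le_one_iff_adj_or_eq.2 (Or.inl (SimpleGraph.pathGraph_adj.2 ?_))
      left; simp only; omega
    push_cast
    exact SimpleGraph.edist_triangle.trans (add_le_add h1 h2)

/-- The first `k + 1` vertices form a clique. Only this lower bound on `χ` is needed to pass from `k
+ 1` to `χ` in the cycle estimate. -/
theorem add_one_le_chi_cyclePower {n k : ℕ} (hn : k + 1 ≤ n) : k + 1 ≤ chi (cyclePower n k) := by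
  let s : Finset (Fin n) := Finset.univ.map (Fin.castLEEmb hn)
  have hlt : ∀ i j : Fin (k + 1), i < j →
      (cyclePower n k).Adj (Fin.castLEEmb hn i) (Fin.castLEEmb hn j) := by
    intro i j hij
    have hij' : (i : ℕ) < j := hij
    refine pathPower_le_cyclePower n k ⟨fun h => hij.ne ((Fin.castLEEmb hn).injective h), ?_⟩
    refine (edist_pathGraph_le ((j : ℕ) - i) _ _ ?_).trans ?_
    · simp; omega
    · have := j.2
      exact_mod_cast (by omega : (j : ℕ) - i ≤ k)
  have hs : (cyclePower n k).IsClique (s : Set (Fin n)) := by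
    intro a ha b hb hab
    simp only [s, Finset.coe_map, Finset.coe_univ, Set.image_univ, Set.mem_range] at ha hb
    obtain ⟨i, rfl⟩ := ha
    obtain ⟨j, rfl⟩ := hb
    rcases lt_trichotomy i j with h | h | h
    · exact hlt i j h
    · exact absurd (by rw [h]) hab
    · exact (hlt j i h).symm
  have h := hs.card_le_chromaticNumber
  rw [← coe_chi] at h
  have : s.card = k + 1 := by simp [s]
  rw [this] at h
  exact_mod_cast h

end PowerFacts

/-! ### Nearly balanced proper colourings of cycle powers with `k + 2` colours. -/

section Colouring

/-- A colouring of positions by blocks: `a` blocks of length `q + 1` followed by blocks of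
length `q`. -/
def blockColour (a q t : ℕ) : ℕ :=
  if t < a * (q + 1) then t % (q + 1) else (t - a * (q + 1)) % q

theorem blockColour_lt {a q : ℕ} (hq : 0 < q) (t : ℕ) : blockColour a q t < q + 1 := by
  unfold blockColour
  split_ifs
  · exact Nat.mod_lt _ (by omega)
  · exact (Nat.mod_lt _ hq).trans (by omega)

theorem mod_ne_mod_of_lt_add {q s t : ℕ} (h1 : s < t) (h2 : t < s + q) : s % q ≠ t % q := by
  intro h
  have h3 : (t - s) % q = 0 := Nat.sub_mod_eq_zero_of_mod_eq h.symm
  rw [Nat.mod_eq_of_lt (by omega)] at h3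
  omega

/-- The colour is the offset inside a block, so equal offsets in consecutive blocks differ by the
length of the earlier block, which is at least `k + 1`. -/
theorem blockColour_ne_of_le_add {a k s t : ℕ} (h1 : s < t) (h2 : t ≤ s + k) :
    blockColour a (k + 1) s ≠ blockColour a (k + 1) t := by
  unfold blockColour
  split_ifs with hs ht ht
  · exact mod_ne_mod_of_lt_add h1 (by omega)
  · obtain ⟨x, hx⟩ : ∃ x, a * (k + 1 + 1) = s + x := ⟨_, (Nat.add_sub_of_le hs.le).symm⟩
    obtain ⟨y, hy⟩ : ∃ y, t = a * (k + 1 + 1) + y := ⟨_, (Nat.add_sub_of_le (by omega)).symm⟩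
    have ha : 0 < a := by
      rcases Nat.eq_zero_or_pos a with h | h
      · subst h; omega
      · exact h
    obtain ⟨a, rfl⟩ : ∃ a', a = a' + 1 := ⟨a - 1, by omega⟩
    have hs' : s = (k + 2 - x) + (k + 1 + 1) * a := by
      have : (a + 1) * (k + 1 + 1) = (k + 1 + 1) * a + (k + 1 + 1) := by ring
      omega
    rw [hs', Nat.add_mul_mod_self_left, Nat.mod_eq_of_lt (by omega), hy, Nat.add_sub_cancel_left,
      Nat.mod_eq_of_lt (by omega)]
    omega
  · omega
  · exact mod_ne_mod_of_lt_add (by omega) (by omega)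

/-- Since `a > 0`, position `s < k` lies in the first block and has colour `s`. Position `t` is at
most `k - s` before the end, so its offset in a last block of length at least `k + 1` exceeds `s`.
-/
theorem blockColour_ne_of_wrap {a b k n s t : ℕ} (hn : n = a * (k + 2) + b * (k + 1)) (ha : 0 < a)
    (ht : t < n) (hst : s + n ≤ t + k) :
    blockColour a (k + 1) s ≠ blockColour a (k + 1) t := by
  have hs : s < a * (k + 1 + 1) := by nlinarith
  unfold blockColour
  rw [if_pos hs, Nat.mod_eq_of_lt (by omega)]
  split_ifs with h
  · have hb : b = 0 := by
      by_contra hb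
      have : k + 1 ≤ b * (k + 1) := Nat.le_mul_of_pos_left _ (by omega)
      have : a * (k + 1 + 1) = a * (k + 2) := rfl
      omega
    subst hb
    obtain ⟨a, rfl⟩ : ∃ a', a = a' + 1 := ⟨a - 1, by omega⟩
    obtain ⟨x, hx⟩ : ∃ x, n = t + x := ⟨_, (Nat.add_sub_of_le ht.le).symm⟩
    have : t = (k + 2 - x) + (k + 1 + 1) * a := by
      have : (a + 1) * (k + 2) = (k + 1 + 1) * a + (k + 1 + 1) := by ring
      omega
    rw [this, Nat.add_mul_mod_self_left, Nat.mod_eq_of_lt (by omega)]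
    omega
  · have hb : 0 < b := by
      rcases Nat.eq_zero_or_pos b with h' | h'
      · subst h'
        have : a * (k + 1 + 1) = a * (k + 2) := rfl
        omega
      · exact h'
    obtain ⟨b, rfl⟩ : ∃ b', b = b' + 1 := ⟨b - 1, by omega⟩
    obtain ⟨x, hx⟩ : ∃ x, n = t + x := ⟨_, (Nat.add_sub_of_le ht.le).symm⟩
    have : t - a * (k + 1 + 1) = (k + 1 - x) + (k + 1) * b := by
      have : (b + 1) * (k + 1) = (k + 1) * b + (k + 1) := by ring
      have : a * (k + 1 + 1) = a * (k + 2) := rfl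
      omega
    rw [this, Nat.add_mul_mod_self_left, Nat.mod_eq_of_lt (by omega)]
    omega

theorem card_blockColour_le {a b k n : ℕ} (hn : n = a * (k + 2) + b * (k + 1)) (x : ℕ) :
    ((Finset.range n).filter fun t => blockColour a (k + 1) t = x).card ≤ a + b := by
  rw [← Finset.card_range (a + b)]
  refine Finset.card_le_card_of_injOn
    (fun t => if t < a * (k + 1 + 1) then t / (k + 1 + 1) else a + (t - a * (k + 1 + 1)) / (k + 1))
    ?_ ?_
  · intro t ht
    simp only [Finset.coe_filter, Finset.mem_range, Set.mem_ofPred_eq] at ht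
    simp only [Finset.coe_range, Set.mem_Iio]
    split_ifs with h
    · exact (Nat.div_lt_of_lt_mul (by rw [mul_comm]; exact h)).trans_le (by omega)
    · refine Nat.add_lt_add_left (Nat.div_lt_of_lt_mul ?_) _
      have : a * (k + 1 + 1) = a * (k + 2) := rfl
      have : (k + 1) * b = b * (k + 1) := mul_comm _ _
      omega
  · intro s hs t ht hst
    simp only [Finset.coe_filter, Finset.mem_range, Set.mem_ofPred_eq] at hs ht
    have h := hs.2.trans ht.2.symm
    unfold blockColour at h
    simp only at hst
    split_ifs at h hst with h1 h2 h2
    · rw [← Nat.div_add_mod s (k + 1 + 1), ← Nat.div_add_mod t (k + 1 + 1), h, hst]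
    · have := Nat.div_lt_of_lt_mul (n := k + 1 + 1) (k := a) (m := s) (by rw [mul_comm]; exact h1)
      generalize (t - a * (k + 1 + 1)) / (k + 1) = y at hst
      omega
    · have := Nat.div_lt_of_lt_mul (n := k + 1 + 1) (k := a) (m := t) (by rw [mul_comm]; exact h2)
      generalize (s - a * (k + 1 + 1)) / (k + 1) = y at hst
      omega
    · have h3 := Nat.div_add_mod (s - a * (k + 1 + 1)) (k + 1)
      have h4 := Nat.div_add_mod (t - a * (k + 1 + 1)) (k + 1)
      rw [h, Nat.add_left_cancel hst] at h3
      omega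

/-- If `k + 2` does not divide `n`, round the number of blocks up and shorten as many blocks by one
as the excess demands. The bound on `n` leaves at least one long block. -/
theorem exists_eq_mul_add_mul {k n : ℕ} (hn : (k + 2) * (k + 2) ≤ n) :
    ∃ a b, 0 < a ∧ b ≤ k + 1 ∧ n = a * (k + 2) + b * (k + 1) := by
  have h1 := Nat.div_add_mod n (k + 2)
  have h2 := Nat.mod_lt n (show 0 < k + 2 by omega)
  have h3 : k + 2 ≤ n / (k + 2) := (Nat.le_div_iff_mul_le (by omega)).2 hn
  generalize n / (k + 2) = q at *
  generalize n % (k + 2) = s at *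
  rcases Nat.eq_zero_or_pos s with h | h
  · exact ⟨q, 0, by omega, by omega, by subst h; rw [← h1]; ring⟩
  · obtain ⟨d, hd⟩ : ∃ d, k + 2 = s + d := ⟨_, (Nat.add_sub_of_le h2.le).symm⟩
    obtain ⟨e, rfl⟩ : ∃ e, d = e + 1 := ⟨d - 1, by omega⟩
    obtain ⟨p, rfl⟩ : ∃ p, q = p + e := ⟨q - e, by omega⟩
    refine ⟨p, e + 1, by omega, by omega, ?_⟩
    have hk : k = s + e - 1 := by omega
    obtain ⟨s, rfl⟩ : ∃ s', s = s' + 1 := ⟨s - 1, by omega⟩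
    have hk : k = s + e := by omega
    subst hk
    rw [← h1]; ring

end Colouring

/-! ### Greedy embedding into nearly complete multipartite graphs. -/

section Greedy

open Classical in
/-- Greedy embedding of a properly coloured graph into a nearly complete multipartite graph. -/
theorem exists_partial_embedding {V : Type*} [Nonempty V] (G : SimpleGraph V) (n k d m : ℕ)
    (col : ℕ → ℕ) (R : ℕ → ℕ → Prop)
    (hR : ∀ s t, s < t → R s t → col s ≠ col t)
    (hRcard : ∀ t < n, ((Finset.range t).filter fun s => R s t).card ≤ k)
    (hcol : ∀ x, ((Finset.range n).filter fun t => col t = x).card ≤ m)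
    (U : ℕ → Finset V)
    (hU : ∀ t < n, m + k * d < (U (col t)).card)
    (hdisj : ∀ s t, s < n → t < n → col s ≠ col t → Disjoint (U (col s)) (U (col t)))
    (hd : ∀ s t, s < n → t < n → col s ≠ col t → ∀ u ∈ U (col s),
      ((U (col t)).filter fun v => ¬ G.Adj u v).card ≤ d) (j : ℕ) (hj : j ≤ n) :
    ∃ f : ℕ → V, (∀ t < j, f t ∈ U (col t)) ∧
      (∀ s t, s < t → t < j → f s ≠ f t ∧ (R s t → G.Adj (f s) (f t))) := by
  induction j with
  | zero => exact ⟨fun _ => Classical.arbitrary V, by simp, by simp⟩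
  | succ j ih =>
    obtain ⟨f, hf1, hf2⟩ := ih (by omega)
    let used := ((Finset.range j).filter fun t => col t = col j).image f
    let bad := ((Finset.range j).filter fun s => R s j).biUnion
      fun s => (U (col j)).filter fun v => ¬ G.Adj (f s) v
    have hused : used.card ≤ m := Finset.card_image_le.trans
      ((Finset.card_le_card (Finset.filter_subset_filter _
        (Finset.range_subset_range.2 (by omega)))).trans (hcol (col j)))
    have hbad : bad.card ≤ k * d := by
      refine (Finset.card_biUnion_le_card_mul _ _ d ?_).trans
        (Nat.mul_le_mul_right _ (hRcard j (by omega)))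
      intro s hs
      simp only [Finset.mem_filter, Finset.mem_range] at hs
      exact hd s j (by omega) (by omega) (hR s j hs.1 hs.2) _ (hf1 s hs.1)
    obtain ⟨v, hv, hv'⟩ : ∃ v ∈ U (col j), v ∉ used ∪ bad := by
      apply Finset.exists_mem_notMem_of_card_lt_card
      exact (Finset.card_union_le _ _).trans_lt (by have := hU j (by omega); omega)
    simp only [Finset.mem_union, not_or] at hv'
    refine ⟨fun t => if t < j then f t else v, ?_, ?_⟩
    · intro t ht
      simp only
      split_ifs with h
      · exact hf1 t h
      · have : t = j := by omega
        subst this; exact hv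
    · intro s t hst ht
      have hs : s < j := by omega
      simp only [if_pos hs]
      split_ifs with h
      · exact hf2 s t hst h
      · have : t = j := by omega
        subst this
        refine ⟨?_, ?_⟩
        · rintro rfl
          by_cases hc : col s = col t
          · exact hv'.1 (Finset.mem_image.2 ⟨s, by simp [hs, hc], rfl⟩)
          · exact Finset.disjoint_left.1 (hdisj s t (by omega) (by omega) hc) (hf1 s hs) hv
        · intro hr
          by_contra hadj
          exact hv'.2 (Finset.mem_biUnion.2 ⟨s, by simp [hs, hr], by simp [hv, hadj]⟩)

theorem cyclePower_isContained_of_forall_lt {V : Type*} (G : SimpleGraph V) (n k : ℕ) (f : ℕ → V)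
    (hinj : ∀ s t, s < t → t < n → f s ≠ f t)
    (hadj : ∀ s t, s < t → t < n → t ≤ s + k ∨ s + n ≤ t + k → G.Adj (f s) (f t)) :
    (cyclePower n k).IsContained G := by
  have key : ∀ u v : Fin n, (u : ℕ) < v → (cyclePower n k).Adj u v → G.Adj (f u) (f v) :=
    fun u v huv h => hadj u v huv v.2 (cyclePower_val_of_adj h huv)
  refine ⟨⟨⟨fun u => f u, fun {u v} h => ?_⟩, fun u v h => ?_⟩⟩
  · rcases lt_trichotomy (u : ℕ) v with huv | huv | huv
    · exact key u v huv h
    · exact absurd (Fin.ext huv) h.ne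
    · exact (key v u huv h.symm).symm
  · change f u = f v at h
    rcases lt_trichotomy (u : ℕ) v with huv | huv | huv
    · exact absurd h (hinj u v huv v.2)
    · exact Fin.ext huv
    · exact absurd h.symm (hinj v u huv u.2)

open Classical in
theorem cyclePower_isContained_of_multipartite {V : Type*} [Nonempty V] (G : SimpleGraph V)
    (n k d m : ℕ) (hn : (k + 2) * (k + 2) ≤ n) (hm : n ≤ (k + 2) * m) (U : Fin (k + 2) → Finset V)
    (hU : ∀ i, m + (k + 1) + 2 * k * d < (U i).card)
    (hdisj : ∀ i j, i ≠ j → Disjoint (U i) (U j))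
    (hd : ∀ i j, i ≠ j → ∀ u ∈ U i, ((U j).filter fun v => ¬ G.Adj u v).card ≤ d) :
    (cyclePower n k).IsContained G := by
  obtain ⟨a, b, ha, hb, hab⟩ := exists_eq_mul_add_mul hn
  have hlt : ∀ t, blockColour a (k + 1) t < k + 2 := fun t => blockColour_lt (by omega) t
  have hn0 : 0 < n := lt_of_lt_of_le (by positivity) hn
  -- Colours are below `k + 2`, so the reduction modulo `k + 2` never identifies two of them.
  let U' : ℕ → Finset V := fun i => U (Fin.ofNat (k + 2) i)
  have hne : ∀ s t, blockColour a (k + 1) s ≠ blockColour a (k + 1) t →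
      Fin.ofNat (k + 2) (blockColour a (k + 1) s) ≠ Fin.ofNat (k + 2) (blockColour a (k + 1) t) := by
    intro s t h h'
    have := congrArg Fin.val h'
    simp only [Fin.val_ofNat, Nat.mod_eq_of_lt (hlt _)] at this
    exact h this
  have ham : a ≤ m := by
    by_contra h
    have : (k + 2) * (m + 1) ≤ (k + 2) * a := Nat.mul_le_mul_left _ (by omega)
    have : (k + 2) * a = a * (k + 2) := mul_comm _ _
    have : (k + 2) * (m + 1) = (k + 2) * m + (k + 2) := by ring
    omega
  obtain ⟨R, hR_iff⟩ : ∃ R : ℕ → ℕ → Prop, ∀ s t, R s t ↔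
      s < t ∧ t < n ∧ (t ≤ s + k ∨ s + n ≤ t + k) := ⟨_, fun _ _ => Iff.rfl⟩
  have hR : ∀ s t, s < t → R s t → blockColour a (k + 1) s ≠ blockColour a (k + 1) t := by
    intro s t hst hr
    obtain ⟨-, ht, h | h⟩ := (hR_iff s t).1 hr
    · exact blockColour_ne_of_le_add hst h
    · exact blockColour_ne_of_wrap hab ha ht h
  have hRcard : ∀ t < n, ((Finset.range t).filter fun s => R s t).card ≤ 2 * k := by
    intro t ht
    -- Earlier neighbours of `t` are the `k` preceding positions and, by wrap-around, at most `k`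
    -- positions at the start.
    have : ((Finset.range t).filter fun s => R s t) ⊆
        Finset.Ico (t - k) t ∪ Finset.range (t + k + 1 - n) := by
      intro s hs
      simp only [Finset.mem_filter, Finset.mem_range, Finset.mem_union, Finset.mem_Ico,
        hR_iff] at hs ⊢
      omega
    refine (Finset.card_le_card this).trans ((Finset.card_union_le _ _).trans ?_)
    rw [Nat.card_Ico, Finset.card_range]
    omega
  obtain ⟨f, hf1, hf2⟩ := exists_partial_embedding G n (2 * k) d (m + (k + 1))
    (blockColour a (k + 1)) R hR hRcard (fun x => (card_blockColour_le hab x).trans (by omega))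
    U' (fun t _ => hU _)
    (fun s t _ _ h => hdisj _ _ (hne s t h)) (fun s t _ _ h => hd _ _ (hne s t h)) n le_rfl
  exact cyclePower_isContained_of_forall_lt G n k f (fun s t hst ht => (hf2 s t hst ht).1)
      (fun s t hst ht h => (hf2 s t hst ht).2 ((hR_iff s t).2 ⟨hst, ht, h⟩))

end Greedy

/-! ### Power sequences, insertion into runs, and appending bridges. -/

section PowerSequences

/-- The first `T` terms of `s` are distinct, and terms at distance at most `k` are adjacent:
a copy of `P_T^k`. -/
structure IsPowerSeq {V : Type*} (G : SimpleGraph V) (k T : ℕ) (s : ℕ → V) : Prop where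
  ne : ∀ a b, a < b → b < T → s a ≠ s b
  adj : ∀ a b, a < b → b < T → b ≤ a + k → G.Adj (s a) (s b)

/-- Among the first `T` terms of `s` there are `2 * k` consecutive ones in `A`. -/
def HasRun {V : Type*} (k T : ℕ) (s : ℕ → V) (A : Finset V) : Prop :=
  ∃ j, j + 2 * k ≤ T ∧ ∀ t, j ≤ t → t < j + 2 * k → s t ∈ A

/-- Insert the value `x` at position `i`. -/
def insertAt {V : Type*} (s : ℕ → V) (i : ℕ) (x : V) (t : ℕ) : V :=
  if t < i then s t else if t = i then x else s (t - 1)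

variable {V : Type*} {G : SimpleGraph V} {k T : ℕ} {s : ℕ → V}

theorem insertAt_of_lt {i t : ℕ} {x : V} (h : t < i) : insertAt s i x t = s t := if_pos h

theorem insertAt_self {i : ℕ} {x : V} : insertAt s i x i = x := by simp [insertAt]

theorem insertAt_succ {i t : ℕ} {x : V} (h : i ≤ t) : insertAt s i x (t + 1) = s t := by
  simp [insertAt, show ¬ t + 1 < i by omega, show ¬ t + 1 = i by omega]

/-- Insertion only moves old terms apart, so only edges at `x` are new. In the middle of a run of
length `2 * k`, all terms within distance `k` of `x` lie in the same clique as `x`. -/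
theorem IsPowerSeq.insertAt (h : IsPowerSeq G k T s) {A : Finset V}
    (hA : ∀ u ∈ A, ∀ v ∈ A, u ≠ v → G.Adj u v) {j : ℕ} (hj : j + 2 * k ≤ T)
    (hrun : ∀ t, j ≤ t → t < j + 2 * k → s t ∈ A) {x : V} (hx : x ∈ A)
    (hxs : ∀ t < T, s t ≠ x) : IsPowerSeq G k (T + 1) (insertAt s (j + k) x) := by
  have cases : ∀ t, t < T + 1 → (t < j + k ∧ _root_.insertAt s (j + k) x t = s t) ∨
      (t = j + k ∧ _root_.insertAt s (j + k) x t = x) ∨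
      ∃ r, t = r + 1 ∧ j + k ≤ r ∧ _root_.insertAt s (j + k) x t = s r := by
    intro t ht
    rcases lt_trichotomy t (j + k) with h | h | h
    · exact Or.inl ⟨h, insertAt_of_lt h⟩
    · exact Or.inr (Or.inl ⟨h, by rw [h, insertAt_self]⟩)
    · exact Or.inr (Or.inr ⟨t - 1, by omega, by omega, by
        conv_lhs => rw [show t = (t - 1) + 1 by omega]
        exact insertAt_succ (by omega)⟩)
  constructor
  · intro a b hab hb
    rcases cases a (by omega) with ⟨ha, ea⟩ | ⟨ha, ea⟩ | ⟨a', rfl, ha, ea⟩ <;>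
    rcases cases b hb with ⟨hb', eb⟩ | ⟨hb', eb⟩ | ⟨b', rfl, hb', eb⟩ <;> rw [ea, eb]
    · exact h.ne _ _ hab (by omega)
    · exact hxs _ (by omega)
    · exact h.ne _ _ (by omega) (by omega)
    · omega
    · omega
    · exact (hxs _ (by omega)).symm
    · omega
    · omega
    · exact h.ne _ _ (by omega) (by omega)
  · intro a b hab hb hk
    rcases cases a (by omega) with ⟨ha, ea⟩ | ⟨ha, ea⟩ | ⟨a', rfl, ha, ea⟩ <;>
    rcases cases b hb with ⟨hb', eb⟩ | ⟨hb', eb⟩ | ⟨b', rfl, hb', eb⟩ <;> rw [ea, eb]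
    · exact h.adj _ _ hab (by omega) hk
    · exact hA _ (hrun _ (by omega) (by omega)) _ hx (hxs _ (by omega))
    · exact h.adj _ _ (by omega) (by omega) (by omega)
    · omega
    · omega
    · exact (hA _ (hrun _ (by omega) (by omega)) _ hx (hxs _ (by omega))).symm
    · omega
    · omega
    · exact h.adj _ _ (by omega) (by omega) (by omega)

/-- Runs survive insertion, so it can be repeated: the run receiving `x` keeps `2 * k` consecutive
terms, and a run in a disjoint set cannot overlap it, hence is at most shifted. -/
theorem HasRun.insertAt {A B : Finset V} (hAB : A = B ∨ Disjoint A B) {j : ℕ} (hk : 1 ≤ k)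
    (hj : j + 2 * k ≤ T) (hrun : ∀ t, j ≤ t → t < j + 2 * k → s t ∈ A) {x : V} (hx : x ∈ A)
    (hB : HasRun k T s B) : HasRun k (T + 1) (insertAt s (j + k) x) B := by
  rcases hAB with rfl | hAB
  · refine ⟨j, by omega, fun t h1 h2 => ?_⟩
    rcases lt_trichotomy t (j + k) with h | h | h
    · rw [insertAt_of_lt h]; exact hrun t h1 h2
    · rw [h, insertAt_self]; exact hx
    · rw [show t = (t - 1) + 1 by omega, insertAt_succ (by omega)]
      exact hrun _ (by omega) (by omega)
  · obtain ⟨i, hi, hi'⟩ := hB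
    have hdis : ∀ t, ¬ (j ≤ t ∧ t < j + 2 * k ∧ i ≤ t ∧ t < i + 2 * k) := fun t ⟨h1, h2, h3, h4⟩ =>
      Finset.disjoint_left.1 hAB (hrun t h1 h2) (hi' t h3 h4)
    have hsep : i + 2 * k ≤ j ∨ j + 2 * k ≤ i := by
      have h1 := hdis i
      have h2 := hdis j
      omega
    rcases hsep with h | h
    · refine ⟨i, by omega, fun t h1 h2 => ?_⟩
      rw [insertAt_of_lt (by omega)]; exact hi' t h1 h2
    · refine ⟨i + 1, by omega, fun t h1 h2 => ?_⟩
      rw [show t = (t - 1) + 1 by omega, insertAt_succ (by omega)]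
      exact hi' _ (by omega) (by omega)

open Classical in
/-- A cyclic power sequence with a run in each of some cliques extends to any length up to the total
size of the cliques. -/
theorem cyclePower_isContained_of_hasRun {ι : Type*} {n : ℕ} (hk : 1 ≤ k) (blk : ι → Finset V)
    (hclq : ∀ a, ∀ u ∈ blk a, ∀ v ∈ blk a, u ≠ v → G.Adj u v)
    (hdis : ∀ a b, a ≠ b → Disjoint (blk a) (blk b)) (X : Finset ι)
    (hn : n ≤ (X.biUnion blk).card) (a₀ : ι) (hT : T ≤ n) (hkT : k ≤ T)
    (hs : IsPowerSeq G k T s)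
    (hfirst : ∀ t < k, s t ∈ blk a₀) (hlast : ∀ t < T, T ≤ t + k → s t ∈ blk a₀)
    (hrun : ∀ a ∈ X, HasRun k T s (blk a)) : (cyclePower n k).IsContained G := by
  obtain ⟨d, hd⟩ : ∃ d, n = T + d := ⟨_, (Nat.add_sub_of_le hT).symm⟩
  induction d generalizing T s with
  | zero =>
    have : n = T := hd
    subst this
    refine cyclePower_isContained_of_forall_lt G n k s hs.ne fun a b hab hb h => ?_
    rcases h with h | h
    · exact hs.adj a b hab hb h
    -- A wrap-around edge joins one of the first `k` terms to one of the last `k`, all of which lie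
    -- in the clique `blk a₀`.
    · exact hclq a₀ _ (hfirst a (by omega)) _ (hlast b hb (by omega)) (hs.ne a b hab hb)
  | succ d ih =>
    obtain ⟨x, hxX, hx⟩ : ∃ x ∈ X.biUnion blk, x ∉ (Finset.range T).image s := by
      apply Finset.exists_mem_notMem_of_card_lt_card
      exact Finset.card_image_le.trans_lt (by rw [Finset.card_range]; omega)
    obtain ⟨a, haX, hxa⟩ := Finset.mem_biUnion.1 hxX
    have hxs : ∀ t < T, s t ≠ x := fun t ht h =>
      hx (Finset.mem_image.2 ⟨t, Finset.mem_range.2 ht, h⟩)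
    obtain ⟨j, hj, hja⟩ := hrun a haX
    refine ih (T := T + 1) (s := insertAt s (j + k) x) (by omega) (by omega)
      (hs.insertAt (hclq a) hj hja hxa hxs) ?_ ?_ ?_ (by omega)
    · intro t ht
      rw [insertAt_of_lt (by omega)]; exact hfirst t ht
    · intro t ht ht'
      rw [show t = (t - 1) + 1 by omega, insertAt_succ (by omega)]
      exact hlast _ (by omega) (by omega)
    · intro b hb
      refine HasRun.insertAt ?_ hk hj hja hxa (hrun b hb)
      by_cases hab : a = b
      · exact Or.inl (by rw [hab])
      · exact Or.inr (hdis a b hab)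

/-- The vertices `e 0, …, e (k - 1)` of `A` and `e k, …, e (2 * k - 1)` of `B` are distinct, avoid
`Z` and span a complete bipartite graph. -/
structure IsBridge (G : SimpleGraph V) (k : ℕ) (A B Z : Finset V) (e : ℕ → V) : Prop where
  left_mem : ∀ i < k, e i ∈ A
  right_mem : ∀ i, k ≤ i → i < 2 * k → e i ∈ B
  notMem : ∀ i < 2 * k, e i ∉ Z
  ne : ∀ i j, i < j → j < 2 * k → e i ≠ e j
  adj : ∀ i j, i < k → k ≤ j → j < 2 * k → G.Adj (e i) (e j)

/-- Continue the first `T` terms of `s` by `e`. -/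
def appendAt (s : ℕ → V) (T : ℕ) (e : ℕ → V) (t : ℕ) : V := if t < T then s t else e (t - T)

theorem appendAt_of_lt {e : ℕ → V} {t : ℕ} (h : t < T) : appendAt s T e t = s t := if_pos h

theorem appendAt_add {e : ℕ → V} (i : ℕ) : appendAt s T e (T + i) = e i := by simp [appendAt]

open Classical in
theorem IsPowerSeq.appendAt (h : IsPowerSeq G k T s) {A B : Finset V}
    (hA : ∀ u ∈ A, ∀ v ∈ A, u ≠ v → G.Adj u v) (hB : ∀ u ∈ B, ∀ v ∈ B, u ≠ v → G.Adj u v)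
    (hlast : ∀ t < T, T ≤ t + k → s t ∈ A) {e : ℕ → V}
    (he : IsBridge G k A B ((Finset.range T).image s) e) :
    IsPowerSeq G k (T + 2 * k) (appendAt s T e) := by
  have cases : ∀ t, t < T + 2 * k → (t < T ∧ _root_.appendAt s T e t = s t) ∨
      ∃ i, t = T + i ∧ i < 2 * k ∧ _root_.appendAt s T e t = e i := by
    intro t ht
    rcases lt_or_ge t T with h | h
    · exact Or.inl ⟨h, appendAt_of_lt h⟩
    · obtain ⟨i, rfl⟩ := Nat.exists_eq_add_of_le h
      exact Or.inr ⟨i, rfl, by omega, appendAt_add i⟩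
  have hse : ∀ t < T, ∀ i < 2 * k, s t ≠ e i := fun t ht i hi hti =>
    he.notMem i hi (Finset.mem_image.2 ⟨t, Finset.mem_range.2 ht, hti⟩)
  constructor
  · intro a b hab hb
    rcases cases a (by omega) with ⟨ha, ea⟩ | ⟨i, rfl, hi, ea⟩ <;>
    rcases cases b hb with ⟨hb', eb⟩ | ⟨j, rfl, hj, eb⟩ <;> rw [ea, eb]
    · exact h.ne _ _ hab hb'
    · exact hse a ha j hj
    · omega
    · exact he.ne i j (by omega) hj
  · intro a b hab hb hk
    rcases cases a (by omega) with ⟨ha, ea⟩ | ⟨i, rfl, hi, ea⟩ <;>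
    rcases cases b hb with ⟨hb', eb⟩ | ⟨j, rfl, hj, eb⟩ <;> rw [ea, eb]
    · exact h.adj _ _ hab hb' hk
    · exact hA _ (hlast a ha (by omega)) _ (he.left_mem j (by omega)) (hse a ha j hj)
    · omega
    · rcases lt_or_ge j k with hjk | hjk
      · exact hA _ (he.left_mem i (by omega)) _ (he.left_mem j hjk) (he.ne i j (by omega) hj)
      · rcases lt_or_ge i k with hik | hik
        · exact he.adj i j hik hjk hj
        · exact hB _ (he.right_mem i hik hi) _ (he.right_mem j hjk hj) (he.ne i j (by omega) hj)

open Classical in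
/-- The number of the first `T` terms of `s` that lie in `A`. -/
noncomputable def usedCount (T : ℕ) (s : ℕ → V) (A : Finset V) : ℕ :=
  ((Finset.range T).filter fun t => s t ∈ A).card

open Classical in
theorem card_image_inter_le_usedCount (A : Finset V) :
    ((Finset.range T).image s ∩ A).card ≤ usedCount T s A := by
  refine (Finset.card_le_card (t := ((Finset.range T).filter fun t => s t ∈ A).image s) ?_).trans
    Finset.card_image_le
  intro x hx
  simp only [Finset.mem_inter, Finset.mem_image, Finset.mem_filter] at hx ⊢
  obtain ⟨⟨t, ht, rfl⟩, h⟩ := hx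
  exact ⟨t, ⟨ht, h⟩, rfl⟩

open Classical in
theorem usedCount_appendAt_le {e : ℕ → V} {m : ℕ} (A : Finset V) :
    usedCount (T + m) (appendAt s T e) A ≤ usedCount T s A + m := by
  unfold usedCount
  have : ((Finset.range (T + m)).filter fun t => appendAt s T e t ∈ A) ⊆
      ((Finset.range T).filter fun t => s t ∈ A) ∪ Finset.Ico T (T + m) := by
    intro t ht
    simp only [Finset.mem_filter, Finset.mem_range, Finset.mem_union, Finset.mem_Ico] at ht ⊢
    rcases lt_or_ge t T with h | h
    · rw [appendAt_of_lt h] at ht; exact Or.inl ⟨h, ht.2⟩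
    · exact Or.inr ⟨h, ht.1⟩
  refine (Finset.card_le_card this).trans ((Finset.card_union_le _ _).trans ?_)
  simp

open Classical in
theorem usedCount_appendAt_le_of_notMem {e : ℕ → V} {m : ℕ} {A : Finset V}
    (he : ∀ i < m, e i ∉ A) : usedCount (T + m) (appendAt s T e) A ≤ usedCount T s A := by
  refine Finset.card_le_card fun t ht => ?_
  simp only [Finset.mem_filter, Finset.mem_range] at ht ⊢
  rcases lt_or_ge t T with h | h
  · rw [appendAt_of_lt h] at ht; exact ⟨h, ht.2⟩
  · obtain ⟨i, rfl⟩ := Nat.exists_eq_add_of_le h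
    rw [appendAt_add] at ht
    exact absurd ht.2 (he i (by omega))

open Classical in
theorem sum_usedCount_le {ι : Type*} (blk : ι → Finset V)
    (hdis : ∀ a b, a ≠ b → Disjoint (blk a) (blk b)) (W : Finset ι) :
    ∑ a ∈ W, usedCount T s (blk a) ≤ T := by
  unfold usedCount
  rw [← Finset.card_biUnion]
  · refine (Finset.card_le_card (t := Finset.range T) ?_).trans (by simp)
    exact Finset.biUnion_subset.2 fun a _ => Finset.filter_subset _ _
  · intro a _ b _ hab
    rw [Function.onFun, Finset.disjoint_left]
    intro t h1 h2
    exact Finset.disjoint_left.1 (hdis a b hab) (Finset.mem_filter.1 h1).2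
      (Finset.mem_filter.1 h2).2

end PowerSequences

/-! ### Threading one closed power sequence through all cliques. -/

section Linking

variable {V ι : Type*} {G : SimpleGraph V} {k T : ℕ} {s : ℕ → V} {blk : ι → Finset V}

/-- A power sequence that starts in the clique `blk a₀`, ends in the clique `blk a`, and has a run
in every other clique that it meets. -/
structure IsLinked (G : SimpleGraph V) (k : ℕ) (blk : ι → Finset V) (a₀ a : ι) (T : ℕ)
    (s : ℕ → V) : Prop where
  seq : IsPowerSeq G k T s
  le : k ≤ T
  first : ∀ t < k, s t ∈ blk a₀
  last : ∀ t < T, T ≤ t + k → s t ∈ blk a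
  unused : ∀ x, x ≠ a → ¬ HasRun k T s (blk x) → usedCount T s (blk x) = 0

-- Passing through `blk a` creates its run: `k` terms on arrival and `k` more from the left side of
-- the bridge. This is why only the current end clique can be met without having a run.
open Classical in
theorem IsLinked.hop {a₀ a b : ι} (h : IsLinked G k blk a₀ a T s)
    (hclq : ∀ a, ∀ u ∈ blk a, ∀ v ∈ blk a, u ≠ v → G.Adj u v)
    (hdis : ∀ a b, a ≠ b → Disjoint (blk a) (blk b)) {e : ℕ → V}
    (he : IsBridge G k (blk a) (blk b) ((Finset.range T).image s) e) :
    IsLinked G k blk a₀ b (T + 2 * k) (appendAt s T e) ∧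
      HasRun k (T + 2 * k) (appendAt s T e) (blk a) ∧
      (∀ A, HasRun k T s A → HasRun k (T + 2 * k) (appendAt s T e) A) ∧
      ∀ x, x ≠ a → x ≠ b →
        usedCount (T + 2 * k) (appendAt s T e) (blk x) ≤ usedCount T s (blk x) := by
  have hle := h.le
  have hruna : HasRun k (T + 2 * k) (appendAt s T e) (blk a) := by
    refine ⟨T - k, by omega, fun t h1 h2 => ?_⟩
    rcases lt_or_ge t T with ht | ht
    · rw [appendAt_of_lt ht]; exact h.last t ht (by omega)
    · obtain ⟨i, rfl⟩ := Nat.exists_eq_add_of_le ht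
      rw [appendAt_add]; exact he.left_mem i (by omega)
  have hruns : ∀ A, HasRun k T s A → HasRun k (T + 2 * k) (appendAt s T e) A := by
    rintro A ⟨j, hj, hj'⟩
    refine ⟨j, by omega, fun t h1 h2 => ?_⟩
    rw [appendAt_of_lt (by omega)]; exact hj' t h1 h2
  have hused : ∀ x, x ≠ a → x ≠ b →
      usedCount (T + 2 * k) (appendAt s T e) (blk x) ≤ usedCount T s (blk x) := by
    intro x hxa hxb
    refine usedCount_appendAt_le_of_notMem fun i hi hix => ?_
    rcases lt_or_ge i k with hik | hik
    · exact Finset.disjoint_left.1 (hdis x a hxa) hix (he.left_mem i hik)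
    · exact Finset.disjoint_left.1 (hdis x b hxb) hix (he.right_mem i hik hi)
  refine ⟨⟨h.seq.appendAt (hclq a) (hclq b) h.last he, by omega, ?_, ?_, ?_⟩, hruna, hruns, hused⟩
  · intro t ht
    rw [appendAt_of_lt (by omega)]; exact h.first t ht
  · intro t ht ht'
    obtain ⟨i, rfl⟩ := Nat.exists_eq_add_of_le (show T ≤ t by omega)
    rw [appendAt_add]; exact he.right_mem i (by omega) (by omega)
  · intro x hxb hx
    have hxa : x ≠ a := fun hxa => hx (hxa ▸ hruna)
    have := h.unused x hxa fun hr => hx (hruns _ hr)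
    have := hused x hxa hxb
    omega

open Classical in
theorem IsLinked.walk {F : SimpleGraph ι} {c : ℕ}
    (hclq : ∀ a, ∀ u ∈ blk a, ∀ v ∈ blk a, u ≠ v → G.Adj u v)
    (hdis : ∀ a b, a ≠ b → Disjoint (blk a) (blk b))
    (hhop : ∀ a b, F.Adj a b → ∀ Z : Finset V, (Z ∩ blk a).card ≤ c → (Z ∩ blk b).card ≤ c →
      ∃ e, IsBridge G k (blk a) (blk b) Z e)
    {a₀ a b : ι} (p : F.Walk a b) (h : IsLinked G k blk a₀ a T s)
    (hc : ∀ x ∈ p.support, usedCount T s (blk x) + 2 * k * p.length ≤ c) :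
    ∃ s' : ℕ → V, IsLinked G k blk a₀ b (T + 2 * k * p.length) s' ∧
      (∀ A, HasRun k T s A → HasRun k (T + 2 * k * p.length) s' A) ∧
      (a ≠ b → HasRun k (T + 2 * k * p.length) s' (blk a)) ∧
      (∀ x, usedCount (T + 2 * k * p.length) s' (blk x) ≤
        usedCount T s (blk x) + 2 * k * p.length) ∧
      ∀ x, x ∉ p.support →
        usedCount (T + 2 * k * p.length) s' (blk x) ≤ usedCount T s (blk x) := by
  induction p generalizing T s with
  | nil => exact ⟨s, by simpa using h, by simp, by simp, by simp, by simp⟩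
  | @cons a d b hadj p ih =>
    simp only [SimpleGraph.Walk.length_cons, SimpleGraph.Walk.support_cons, List.mem_cons,
      forall_eq_or_imp, mul_add, mul_one, not_or] at hc ⊢
    obtain ⟨hca, hcp⟩ := hc
    obtain ⟨e, he⟩ := hhop a d hadj ((Finset.range T).image s)
      ((card_image_inter_le_usedCount _).trans (by omega))
      ((card_image_inter_le_usedCount _).trans (by have := hcp d p.start_mem_support; omega))
    obtain ⟨h1, h2, h3, h4⟩ := h.hop hclq hdis he
    have h5 : ∀ x, usedCount (T + 2 * k) (appendAt s T e) (blk x) ≤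
        usedCount T s (blk x) + 2 * k := fun x => usedCount_appendAt_le _
    obtain ⟨s', i1, i2, -, i4, i5⟩ := ih h1 fun x hx => by
      have := h5 x
      have := hcp x hx
      omega
    rw [show T + (2 * k * p.length + 2 * k) = T + 2 * k + 2 * k * p.length by ring]
    refine ⟨s', i1, fun A hA => i2 A (h3 A hA), fun _ => i2 _ h2, fun x => ?_, ?_⟩
    · have := h5 x
      have := i4 x
      omega
    · rintro x ⟨hxa, hxp⟩
      exact (i5 x hxp).trans (h4 x hxa fun hxd => hxp (hxd ▸ p.start_mem_support))

open Classical in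
theorem IsLinked.usedCount_pos {a₀ a : ι} (h : IsLinked G k blk a₀ a T s) (hk : 1 ≤ k) :
    0 < usedCount T s (blk a₀) :=
  Finset.card_pos.2 ⟨0, Finset.mem_filter.2 ⟨Finset.mem_range.2 (by have := h.le; omega),
    h.first 0 (by omega)⟩⟩

theorem exists_isLinked_init (a₀ : ι) (hV : k ≤ (blk a₀).card) (hk : 1 ≤ k)
    (hclq : ∀ u ∈ blk a₀, ∀ v ∈ blk a₀, u ≠ v → G.Adj u v)
    (hdis : ∀ a b, a ≠ b → Disjoint (blk a) (blk b)) : ∃ s, IsLinked G k blk a₀ a₀ k s := by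
  classical
  obtain ⟨v₀, hv₀⟩ := Finset.card_pos.1 (show 0 < (blk a₀).card by omega)
  let f := (blk a₀).equivFin.symm
  let s : ℕ → V := fun t => if h : t < k then (f ⟨t, h.trans_le hV⟩ : V) else v₀
  have hs : ∀ t < k, s t ∈ blk a₀ := by
    intro t ht
    simp only [s, dif_pos ht]
    exact (f _).2
  have hne : ∀ a b, a < b → b < k → s a ≠ s b := by
    intro a b hab hb h
    simp only [s, dif_pos hb, dif_pos (hab.trans hb)] at h
    have := f.injective (Subtype.ext h)
    simp only [Fin.mk.injEq] at this
    omega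
  refine ⟨s, ⟨hne, fun a b hab hb _ => hclq _ (hs a (by omega)) _ (hs b hb) (hne a b hab hb)⟩,
    le_rfl, hs, fun t ht _ => hs t ht, fun x hx _ => ?_⟩
  refine Finset.card_eq_zero.2 (Finset.filter_eq_empty_iff.2 fun t ht h => ?_)
  exact Finset.disjoint_left.1 (hdis x a₀ hx) h (hs t (Finset.mem_range.1 ht))

open Classical in
/-- If `X` indexes robustly linked cliques, then they carry a power of a cycle of any length up to
their total size. -/
theorem cyclePower_isContained_of_linked (n D cap w : ℕ) (hk : 1 ≤ k) (hD : 1 ≤ D)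
    (F : SimpleGraph ι) (X : Finset ι)
    (hclq : ∀ a, ∀ u ∈ blk a, ∀ v ∈ blk a, u ≠ v → G.Adj u v)
    (hdis : ∀ a b, a ≠ b → Disjoint (blk a) (blk b))
    (hbig : ∀ a, k ≤ (blk a).card)
    (hhop : ∀ a b, F.Adj a b → ∀ Z : Finset V, (Z ∩ blk a).card ≤ cap + 4 * k * D →
      (Z ∩ blk b).card ≤ cap + 4 * k * D → ∃ e, IsBridge G k (blk a) (blk b) Z e)
    (hconn : ∀ W ⊆ X, W.card ≤ w → ∀ a ∈ X \ W, ∀ b ∈ X \ W, ∃ p : F.Walk a b, p.length ≤ D ∧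
      ∀ x ∈ p.support, x ∈ X \ W)
    (hcap : 2 * k * D ≤ cap) (hw : k + 2 * k * D * X.card ≤ w * cap) (hX : 2 ≤ X.card)
    (hT : k + 2 * k * D * X.card ≤ n) (hn : n ≤ (X.biUnion blk).card) :
    (cyclePower n k).IsContained G := by
  obtain ⟨a₀, ha₀⟩ := Finset.card_pos.1 (show 0 < X.card by omega)
  have hkD : 1 ≤ k * D := Nat.mul_pos hk hD
  have hkD' : 2 * k * D = 2 * (k * D) := by ring
  have hkD4 : 4 * k * D = 4 * (k * D) := by ring
  have hkk : k ≤ k * D := Nat.le_mul_of_pos_right _ hD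
  -- Cliques with more than `cap` used terms are saturated. The total length bounds their number by
  -- `w`, so connecting walks can avoid them.
  have hsat : ∀ T s, T ≤ k + 2 * k * D * X.card →
      (X.filter fun x => cap < usedCount T s (blk x)).card ≤ w := by
    intro T s hTs
    have h1 : (X.filter fun x => cap < usedCount T s (blk x)).card * cap ≤ T := by
      refine le_trans ?_ (sum_usedCount_le (T := T) (s := s) blk hdis
        (X.filter fun x => cap < usedCount T s (blk x)))
      rw [← smul_eq_mul]
      exact Finset.card_nsmul_le_sum _ _ _ fun x hx => (Finset.mem_filter.1 hx).2.le
    exact Nat.le_of_mul_le_mul_right (h1.trans (hTs.trans hw)) (by omega)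
  -- Each round walks to a clique without a run, through unsaturated cliques only. Usage then never
  -- exceeds `cap` plus one walk. The last clause will force the final end clique to differ from
  -- `a₀`.
  have main : ∀ j, j + 1 ≤ X.card → ∃ T s a, a ∈ X ∧ IsLinked G k blk a₀ a T s ∧
      T ≤ k + 2 * k * D * j ∧ (∀ x, usedCount T s (blk x) ≤ cap + 2 * k * D) ∧
      usedCount T s (blk a) ≤ 2 * k * D ∧
      (X.filter fun x => x ≠ a ∧ ¬ HasRun k T s (blk x)).card + j + 1 ≤ X.card ∧
      (a = a₀ → T = k) := by
    intro j
    induction j with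
    | zero =>
      intro _
      obtain ⟨s, hs⟩ := exists_isLinked_init a₀ (hbig a₀) hk (hclq a₀) hdis
      have hle : ∀ x, usedCount k s (blk x) ≤ k := fun x =>
        (Finset.card_filter_le _ _).trans (by simp)
      refine ⟨k, s, a₀, ha₀, hs, by omega, fun x => (hle x).trans (by omega),
        (hle a₀).trans (by omega), ?_, fun _ => rfl⟩
      have : (X.filter fun x => x ≠ a₀ ∧ ¬ HasRun k k s (blk x)) ⊆ X.erase a₀ := by
        intro x hx
        simp only [Finset.mem_filter] at hx
        exact Finset.mem_erase.2 ⟨hx.2.1, hx.1⟩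
      have := Finset.card_le_card this
      rw [Finset.card_erase_of_mem ha₀] at this
      omega
    | succ j ih =>
      intro hj
      obtain ⟨T, s, a, haX, hs, hTj, hused, hua, hun, ha0⟩ := ih (by omega)
      have hTj' : 2 * k * D * (j + 1) = 2 * k * D * j + 2 * k * D := by ring
      rcases Finset.eq_empty_or_nonempty (X.filter fun x => x ≠ a ∧ ¬ HasRun k T s (blk x))
        with hempty | ⟨b, hb⟩
      · refine ⟨T, s, a, haX, hs, by omega, hused, hua, ?_, ha0⟩
        rw [hempty, Finset.card_empty]
        omega
      have hb' := hb
      simp only [Finset.mem_filter] at hb'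
      obtain ⟨hbX, hba, hbrun⟩ := hb'
      -- A clique without a run other than the current one is untouched, hence unsaturated and a
      -- legal target; it is not `a₀`, which is used from the start.
      have hub := hs.unused b hba hbrun
      have hba0 : b ≠ a₀ := by
        rintro rfl
        have := hs.usedCount_pos hk
        omega
      have hTX : T ≤ k + 2 * k * D * X.card :=
        hTj.trans (Nat.add_le_add_left (Nat.mul_le_mul_left _ (by omega)) _)
      obtain ⟨p, hpD, hp⟩ := hconn _ (Finset.filter_subset _ _) (hsat T s hTX) a
        (by simp only [Finset.mem_sdiff, Finset.mem_filter, not_and, not_lt]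
            exact ⟨haX, fun _ => by omega⟩) b
        (by simp only [Finset.mem_sdiff, Finset.mem_filter, not_and, not_lt]
            exact ⟨hbX, fun _ => by omega⟩)
      have hlen : 2 * k * p.length ≤ 2 * k * D := Nat.mul_le_mul_left _ hpD
      have hsupp : ∀ x ∈ p.support, usedCount T s (blk x) ≤ cap := by
        intro x hx
        have := hp x hx
        simp only [Finset.mem_sdiff, Finset.mem_filter, not_and, not_lt] at this
        exact this.2 this.1
      obtain ⟨s', h1, h2, h3, h4, h5⟩ := hs.walk hclq hdis hhop p fun x hx => by
        have := hsupp x hx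
        omega
      refine ⟨_, s', b, hbX, h1, by omega, fun x => ?_, ?_, ?_, fun h => absurd h hba0⟩
      · by_cases hx : x ∈ p.support
        · have := hsupp x hx
          have := h4 x
          omega
        · exact (h5 x hx).trans (hused x)
      · have := h4 b
        omega
      · have hsub : (X.filter fun x => x ≠ b ∧ ¬ HasRun k (T + 2 * k * p.length) s' (blk x)) ⊆
            (X.filter fun x => x ≠ a ∧ ¬ HasRun k T s (blk x)).erase b := by
          intro x hx
          simp only [Finset.mem_filter, Finset.mem_erase] at hx ⊢
          exact ⟨hx.2.1, hx.1, fun hxa => hx.2.2 (hxa ▸ h3 hba.symm), fun hr => hx.2.2 (h2 _ hr)⟩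
        have := Finset.card_le_card hsub
        rw [Finset.card_erase_of_mem hb] at this
        have := Finset.card_ne_zero_of_mem hb
        omega
  obtain ⟨T, s, a, haX, hs, hTj, hused, hua, hun, ha0⟩ := main (X.card - 1) (by omega)
  have hTX : T + 2 * k * D ≤ k + 2 * k * D * X.card := by
    have : 2 * k * D * X.card = 2 * k * D * (X.card - 1) + 2 * k * D := by
      conv_lhs => rw [show X.card = X.card - 1 + 1 by omega]
      ring
    omega
  have hrun : ∀ x ∈ X, x ≠ a → HasRun k T s (blk x) := by
    intro x hx hxa
    by_contra h
    have hmem : x ∈ X.filter fun x => x ≠ a ∧ ¬ HasRun k T s (blk x) :=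
      Finset.mem_filter.2 ⟨hx, hxa, h⟩
    have := Finset.card_ne_zero_of_mem hmem
    omega
  have haa₀ : a ≠ a₀ := by
    rintro rfl
    obtain ⟨x, hx, hxa⟩ := Finset.exists_mem_ne (show 1 < X.card by omega) a
    obtain ⟨i, hi, -⟩ := hrun x hx hxa
    have := ha0 rfl
    omega
  -- The closing walk must end at `a₀`, which may be saturated, so `a₀` is exempted. The tolerance
  -- `cap + 4 * k * D` covers the usage `cap + 2 * k * D` and this one extra walk.
  obtain ⟨p, hpD, hp⟩ := hconn ((X.filter fun x => cap < usedCount T s (blk x)).erase a₀)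
    ((Finset.erase_subset _ _).trans (Finset.filter_subset _ _))
    ((Finset.card_le_card (Finset.erase_subset _ _)).trans (hsat T s (by omega))) a
    (by simp only [Finset.mem_sdiff, Finset.mem_erase, Finset.mem_filter, not_and, not_lt]
        exact ⟨haX, fun _ _ => by omega⟩) a₀ (by simp [ha₀])
  have hlen : 2 * k * p.length ≤ 2 * k * D := Nat.mul_le_mul_left _ hpD
  obtain ⟨s', h1, h2, h3, -, -⟩ := hs.walk hclq hdis hhop p fun x _ => by
    have := hused x
    omega
  refine cyclePower_isContained_of_hasRun hk blk hclq hdis X hn a₀ (by omega) h1.le h1.seq h1.first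
    h1.last fun x hx => ?_
  by_cases hxa : x = a
  · exact hxa ▸ h3 haa₀
  · exact h2 _ (hrun x hx hxa)

end Linking

/-! ### Partitions without sparse cuts and robust connectivity. -/

section CutDense

open Classical in
/-- The vertices of a graph can be partitioned into classes that have no sparse cut, with few edges
between different classes. -/
theorem exists_cutDense_partition {V : Type*} [Fintype V] [Nonempty V] (F : SimpleGraph V)
    {η : ℝ} (hη : 0 ≤ η) : ∃ c : V → V,
      (((Finset.univ : Finset (V × V)).filter fun p => c p.1 ≠ c p.2 ∧ F.Adj p.1 p.2).card : ℝ) ≤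
        η * (Fintype.card V : ℝ) ^ 2 ∧
      ∀ x, ∀ Y Z : Finset V, Disjoint Y Z → Y ∪ Z = Finset.univ.filter (fun u => c u = x) →
        η * (Y.card * Z.card) ≤ ((F.interedges Y Z).card : ℝ) := by
  -- A minimiser of the number of crossing adjacent pairs minus `η` times the number of crossing
  -- pairs has both properties: compare it with the one-class partition, and with the result of
  -- splitting one class.
  let wt : V → V → ℝ := fun u v => (if F.Adj u v then 1 else 0) - η
  let Φ : (V → V) → ℝ := fun c => ∑ u, ∑ v, if c u ≠ c v then wt u v else 0
  obtain ⟨c, hc⟩ := Finite.exists_min Φ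
  refine ⟨c, ?_, ?_⟩
  · have h0 : Φ c ≤ 0 := by
      refine (hc fun _ => Classical.arbitrary V).trans (le_of_eq ?_)
      simp [Φ]
    have h1 : Φ c = ((Finset.univ : Finset (V × V)).filter
          fun p => c p.1 ≠ c p.2 ∧ F.Adj p.1 p.2).card -
        η * ((Finset.univ : Finset (V × V)).filter fun p => c p.1 ≠ c p.2).card := by
      simp only [Φ, wt]
      rw [← Fintype.sum_prod_type' (f := fun u v => if c u ≠ c v then
        ((if F.Adj u v then 1 else 0) - η : ℝ) else 0), ← Finset.sum_filter,
        Finset.sum_sub_distrib, ← Finset.sum_filter, Finset.filter_filter]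
      simp [mul_comm]
    have h2 : (((Finset.univ : Finset (V × V)).filter fun p => c p.1 ≠ c p.2).card : ℝ) ≤
        (Fintype.card V : ℝ) ^ 2 := by
      have := Finset.card_filter_le (Finset.univ : Finset (V × V)) fun p => c p.1 ≠ c p.2
      rw [Finset.card_univ, Fintype.card_prod] at this
      rw [sq]
      exact_mod_cast this
    have := mul_le_mul_of_nonneg_left h2 hη
    linarith
  · intro x Y Z hYZ hx
    have hY : ∀ u ∈ Y, c u = x := fun u hu => by
      have : u ∈ Y ∪ Z := Finset.mem_union_left _ hu
      rw [hx] at this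
      exact (Finset.mem_filter.1 this).2
    have hZ : ∀ u ∈ Z, c u = x := fun u hu => by
      have : u ∈ Y ∪ Z := Finset.mem_union_right _ hu
      rw [hx] at this
      exact (Finset.mem_filter.1 this).2
    have hYZx : ∀ u, u ∉ Y → u ∉ Z → c u ≠ x := fun u h1 h2 h => by
      have : u ∈ Y ∪ Z := by rw [hx]; simp [h]
      simp [h1, h2] at this
    rcases Y.eq_empty_or_nonempty with rfl | ⟨y, hy⟩
    · simp
    rcases Z.eq_empty_or_nonempty with rfl | ⟨z, hz⟩
    · simp
    have hninj : ¬ Function.Injective c := fun h =>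
      Finset.disjoint_left.1 hYZ hy (h ((hY y hy).trans (hZ z hz).symm) ▸ hz)
    -- A free label for the split-off part exists because `c`, a self-map of a finite set, is not
    -- injective.
    obtain ⟨t, ht⟩ : ∃ t, ∀ u, c u ≠ t := by
      by_contra! h
      exact hninj (Finite.injective_iff_surjective.2 h)
    have htx : t ≠ x := fun h => ht y ((hY y hy).trans h.symm)
    let c' : V → V := fun u => if u ∈ Y then t else c u
    have hterm : ∀ u v, (if c' u ≠ c' v then wt u v else 0) =
        (if c u ≠ c v then wt u v else 0) + (if u ∈ Y then if v ∈ Z then wt u v else 0 else 0) +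
          (if u ∈ Z then if v ∈ Y then wt u v else 0 else 0) := by
      intro u v
      have hdu : u ∈ Y → u ∉ Z := fun h => Finset.disjoint_left.1 hYZ h
      have hdv : v ∈ Y → v ∉ Z := fun h => Finset.disjoint_left.1 hYZ h
      by_cases hu : u ∈ Y <;> by_cases hv : v ∈ Y
      · simp [c', hu, hv, hdu hu, hdv hv, hY u hu, hY v hv]
      · by_cases hv' : v ∈ Z
        · simp [c', hu, hv, hdu hu, hv', hY u hu, hZ v hv', htx]
        · simp [c', hu, hv, hdu hu, hv', hY u hu, (ht v).symm, (hYZx v hv hv').symm]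
      · by_cases hu' : u ∈ Z
        · simp [c', hu, hv, hu', hY v hv, hZ u hu', htx.symm]
        · simp [c', hu, hv, hu', hY v hv, ht u, hYZx u hu hu']
      · simp [c', hu, hv]
    have hsum : Φ c' = Φ c + (∑ u ∈ Y, ∑ v ∈ Z, wt u v) + ∑ u ∈ Z, ∑ v ∈ Y, wt u v := by
      simp only [Φ, hterm, Finset.sum_add_distrib]
      simp [Finset.sum_ite_mem]
    have hsymm : (∑ u ∈ Z, ∑ v ∈ Y, wt u v) = ∑ u ∈ Y, ∑ v ∈ Z, wt u v := by
      rw [Finset.sum_comm]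
      simp only [wt, F.adj_comm]
    have hval : (∑ u ∈ Y, ∑ v ∈ Z, wt u v) =
        ((F.interedges Y Z).card : ℝ) - η * (Y.card * Z.card) := by
      rw [SimpleGraph.interedges_def, ← Finset.sum_product']
      simp [wt, Finset.sum_sub_distrib, mul_comm]
    have := hc c'
    rw [hsum, hsymm, hval] at this
    linarith

open Classical in
/-- A graph without sparse cuts stays connected, with bounded diameter, after the deletion of few
vertices. -/
theorem exists_walk_of_cutDense {V : Type*} (F : SimpleGraph V) {η : ℝ} (hη : 0 < η)
    (X : Finset V)
    (hX : ∀ Y ⊆ X, η * (Y.card * (X \ Y).card) ≤ ((F.interedges Y (X \ Y)).card : ℝ))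
    (W : Finset V) (hW : (W.card : ℝ) ≤ η * X.card / 4) (m : ℕ) (hm : 2 < m * η)
    (a b : V) (ha : a ∈ X \ W) (hb : b ∈ X \ W) :
    ∃ p : F.Walk a b, p.length ≤ 2 * m ∧ ∀ x ∈ p.support, x ∈ X \ W := by
  let ball : V → ℕ → Finset V := fun a i => (X \ W).filter fun v =>
    ∃ p : F.Walk a v, p.length ≤ i ∧ ∀ x ∈ p.support, x ∈ X \ W
  have hself : ∀ a ∈ X \ W, ∀ i, a ∈ ball a i := fun a ha i =>
    Finset.mem_filter.2 ⟨ha, .nil, by simp, by simpa using ha⟩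
  have hmono : ∀ a i, ball a i ⊆ ball a (i + 1) := by
    intro a i v hv
    simp only [ball, Finset.mem_filter] at hv ⊢
    obtain ⟨h, p, hp, hp'⟩ := hv
    exact ⟨h, p, by omega, hp'⟩
  -- Up to half of `X`, a ball sends so many edges outwards that its boundary has at least `η *
  -- X.card / 2` vertices, of which `W` takes at most half. After `m` steps every ball exceeds half
  -- of `X`, so any two intersect.
  have hgrow : ∀ a ∈ X \ W, ∀ i, ((ball a i).card : ℝ) ≤ X.card / 2 →
      ((ball a i).card : ℝ) + η * X.card / 4 ≤ (ball a (i + 1)).card := by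
    intro a ha i hi
    set Y := ball a i with hYdef
    have hYX : Y ⊆ X := (Finset.filter_subset _ _).trans Finset.sdiff_subset
    have hYpos : (0 : ℝ) < Y.card := by exact_mod_cast Finset.card_pos.2 ⟨a, hself a ha i⟩
    let N := ((X \ W) \ Y).filter fun v => ∃ u ∈ Y, F.Adj u v
    have h1 : F.interedges Y (X \ Y) ⊆ Y ×ˢ (N ∪ W) := by
      rintro ⟨u, v⟩ huv
      rw [SimpleGraph.mem_interedges_iff] at huv
      obtain ⟨hu, hv, hadj⟩ := huv
      rw [Finset.mem_sdiff] at hv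
      refine Finset.mem_product.2 ⟨hu, ?_⟩
      by_cases hvW : v ∈ W
      · exact Finset.mem_union_right _ hvW
      · exact Finset.mem_union_left _ (Finset.mem_filter.2
          ⟨by simp [hv.1, hv.2, hvW], u, hu, hadj⟩)
    have h2 : ((F.interedges Y (X \ Y)).card : ℝ) ≤ Y.card * (N.card + W.card) := by
      have := Finset.card_le_card h1
      rw [Finset.card_product] at this
      have h3 := this.trans (Nat.mul_le_mul_left _ (Finset.card_union_le N W))
      exact_mod_cast h3
    have h3 := (hX Y hYX).trans h2
    rw [Finset.card_sdiff_of_subset hYX, Nat.cast_sub (Finset.card_le_card hYX)] at h3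
    have h4 : η * (X.card - Y.card) ≤ N.card + W.card := by
      have : (Y.card : ℝ) * (η * (X.card - Y.card)) ≤ Y.card * (N.card + W.card) := by linarith
      exact le_of_mul_le_mul_left this hYpos
    have h5 : η * (X.card / 2) ≤ η * (X.card - Y.card : ℝ) :=
      mul_le_mul_of_nonneg_left (by linarith) hη.le
    have h6 : Disjoint Y N := by
      rw [Finset.disjoint_left]
      intro v hv hv'
      exact (Finset.mem_sdiff.1 (Finset.mem_filter.1 hv').1).2 hv
    have h7 : Y ∪ N ⊆ ball a (i + 1) := by
      refine Finset.union_subset (hmono a i) fun v hv => ?_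
      obtain ⟨hv1, u, hu, hadj⟩ := Finset.mem_filter.1 hv
      have hv2 := (Finset.mem_sdiff.1 hv1).1
      obtain ⟨-, p, hp, hp'⟩ := Finset.mem_filter.1 hu
      refine Finset.mem_filter.2 ⟨hv2, p.concat hadj, by simp [hp], fun x hx => ?_⟩
      rw [SimpleGraph.Walk.support_concat, List.mem_append] at hx
      rcases hx with hx | hx
      · exact hp' x hx
      · rw [List.mem_singleton] at hx
        exact hx ▸ hv2
    have h8 := Finset.card_le_card h7
    rw [Finset.card_union_of_disjoint h6] at h8
    have h9 : (Y.card : ℝ) + N.card ≤ (ball a (i + 1)).card := by exact_mod_cast h8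
    linarith
  have hXpos : (0 : ℝ) < X.card := by
    exact_mod_cast Finset.card_pos.2 ⟨a, (Finset.mem_sdiff.1 ha).1⟩
  have hlarge : ∀ a ∈ X \ W, (X.card : ℝ) / 2 < (ball a m).card := by
    intro a ha
    have : ∀ i : ℕ, (X.card : ℝ) / 2 < (ball a i).card ∨ i * (η * X.card / 4) ≤ (ball a i).card := by
      intro i
      induction i with
      | zero => right; simp
      | succ i ih =>
        rcases lt_or_ge ((X.card : ℝ) / 2) (ball a i).card with h | h
        · left
          exact h.trans_le (by exact_mod_cast Finset.card_le_card (hmono a i))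
        · right
          have := hgrow a ha i h
          have := ih.resolve_left (not_lt.2 h)
          push_cast
          linarith
    rcases this m with h | h
    · exact h
    · refine lt_of_lt_of_le ?_ h
      have := mul_lt_mul_of_pos_right hm hXpos
      linarith
  obtain ⟨v, hv⟩ : (ball a m ∩ ball b m).Nonempty := by
    by_contra h
    rw [Finset.not_nonempty_iff_eq_empty, ← Finset.disjoint_iff_inter_eq_empty] at h
    have h1 := Finset.card_le_card (Finset.union_subset
      ((Finset.filter_subset _ _).trans Finset.sdiff_subset : ball a m ⊆ X)
      ((Finset.filter_subset _ _).trans Finset.sdiff_subset : ball b m ⊆ X))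
    rw [Finset.card_union_of_disjoint h] at h1
    have h2 : ((ball a m).card : ℝ) + (ball b m).card ≤ X.card := by exact_mod_cast h1
    have := hlarge a ha
    have := hlarge b hb
    linarith
  obtain ⟨hva, hvb⟩ := Finset.mem_inter.1 hv
  obtain ⟨-, p, hp, hp'⟩ := Finset.mem_filter.1 hva
  obtain ⟨-, q, hq, hq'⟩ := Finset.mem_filter.1 hvb
  refine ⟨p.append q.reverse, by simp; omega, fun x hx => ?_⟩
  rw [SimpleGraph.Walk.mem_support_append_iff] at hx
  rcases hx with hx | hx
  · exact hp' x hx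
  · rw [SimpleGraph.Walk.support_reverse, List.mem_reverse] at hx
    exact hq' x hx

end CutDense

/-! ### Complete bipartite graphs between dense pairs of cliques. -/

section Bridges

theorem exists_isBridge_of_complete {V : Type*} {G : SimpleGraph V} {k : ℕ} (hk : 1 ≤ k)
    {A B Z S S' : Finset V}
    (hS : S.card = k) (hS' : S'.card = k) (hSA : S ⊆ A) (hSB : S' ⊆ B) (hAB : Disjoint A B)
    (hSZ : Disjoint S Z) (hSZ' : Disjoint S' Z) (hadj : ∀ u ∈ S, ∀ v ∈ S', G.Adj u v) :
    ∃ e, IsBridge G k A B Z e := by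
  obtain ⟨v₀, -⟩ := Finset.card_pos.1 (show 0 < S.card by omega)
  let f := S.equivFinOfCardEq hS
  let g := S'.equivFinOfCardEq hS'
  let e : ℕ → V := fun i => if h : i < k then f.symm ⟨i, h⟩ else
    if h' : i - k < k then g.symm ⟨i - k, h'⟩ else v₀
  have hl : ∀ i < k, e i ∈ S := by
    intro i hi
    simp only [e, dif_pos hi]
    exact (f.symm _).2
  have hr : ∀ i, k ≤ i → i < 2 * k → e i ∈ S' := by
    intro i hi hi'
    simp only [e, dif_neg (not_lt.2 hi), dif_pos (show i - k < k by omega)]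
    exact (g.symm _).2
  refine ⟨e, fun i hi => hSA (hl i hi), fun i hi hi' => hSB (hr i hi hi'), ?_, ?_,
    fun i j hi hj hj' => hadj _ (hl i hi) _ (hr j hj hj')⟩
  · intro i hi
    rcases lt_or_ge i k with h | h
    · exact Finset.disjoint_left.1 hSZ (hl i h)
    · exact Finset.disjoint_left.1 hSZ' (hr i h hi)
  · intro i j hij hj heq
    rcases lt_or_ge i k with h | h <;> rcases lt_or_ge j k with h' | h'
    · simp only [e, dif_pos h, dif_pos h'] at heq
      have := f.symm.injective (Subtype.ext heq)
      simp only [Fin.mk.injEq] at this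
      omega
    · exact Finset.disjoint_left.1 hAB (hSA (hl i h)) (heq ▸ hSB (hr j h' hj))
    · omega
    · simp only [e, dif_neg (not_lt.2 h), dif_neg (not_lt.2 h'), dif_pos (show i - k < k by omega),
        dif_pos (show j - k < k by omega)] at heq
      have := g.symm.injective (Subtype.ext heq)
      simp only [Fin.mk.injEq] at this
      omega

open Classical in
/-- A dense bipartite graph contains a complete bipartite graph that avoids a small set. -/
theorem exists_isBridge_of_dense {k : ℕ} (hk : 1 ≤ k) (c : ℕ) {η : ℝ} (hη : 0 < η) :
    ∃ M₀ : ℕ, ∀ M ≥ M₀, ∀ (V : Type) (G : SimpleGraph V) (A B Z : Finset V), A.card = M → B.card = M → Disjoint A B →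
      η * (M : ℝ) ^ 2 ≤ (G.interedges A B).card → (Z ∩ A).card ≤ c → (Z ∩ B).card ≤ c →
      ∃ e, IsBridge G k A B Z e := by
  -- The Kővári–Sós–Turán argument: fix `q` vertices of high degree in `B \ Z`; many vertices of `A
  -- \ Z` have `k` neighbours among them, and by pigeonhole over the `2 ^ q` subsets, `k` of these
  -- share the same `k` neighbours.
  obtain ⟨q, hq⟩ := exists_nat_ge (8 * k / η)
  obtain ⟨M₀, hM₀⟩ := exists_nat_ge (max (max (4 * c / η) (4 * q / η)) (8 * (2 ^ q * k + 1) / η))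
  refine ⟨M₀ + 1, fun M hM V G A B Z hA hB hAB hdense hZA hZB => ?_⟩
  have hMM : (M₀ : ℝ) + 1 ≤ M := by exact_mod_cast hM
  have hM1 := (le_max_left _ _).trans ((le_max_left _ _).trans hM₀)
  have hM2 := (le_max_right _ _).trans ((le_max_left _ _).trans hM₀)
  have hM3 := (le_max_right _ _).trans hM₀
  rw [div_le_iff₀ hη] at hq hM1 hM2 hM3
  have hMpos : (0 : ℝ) < M := by have := M₀.cast_nonneg (α := ℝ); linarith
  have hMη : (M₀ : ℝ) * η ≤ M * η := mul_le_mul_of_nonneg_right (by linarith) hη.le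
  let deg : V → ℕ := fun v => ((A \ Z).filter fun u => G.Adj u v).card
  let H := (B \ Z).filter fun v => η / 4 * M ≤ deg v
  have hcount : ((G.interedges A B).card : ℝ) ≤ c * M + c * M + (H.card * M + M * (η / 4 * M)) := by
    have h1 : G.interedges A B ⊆ ((Z ∩ A) ×ˢ B ∪ A ×ˢ (Z ∩ B)) ∪ G.interedges (A \ Z) (B \ Z) := by
      rintro ⟨u, v⟩ huv
      rw [SimpleGraph.mem_interedges_iff] at huv
      simp only [Finset.mem_union, Finset.mem_product, Finset.mem_inter,
        SimpleGraph.mem_interedges_iff, Finset.mem_sdiff]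
      tauto
    have h2 : (G.interedges (A \ Z) (B \ Z)).card = ∑ v ∈ B \ Z, deg v := by
      rw [SimpleGraph.interedges_def, Finset.card_filter, Finset.sum_product_right]
      simp only [deg, Finset.card_filter]
    have h3 : ((∑ v ∈ B \ Z, deg v : ℕ) : ℝ) ≤ H.card * M + M * (η / 4 * M) := by
      rw [← Finset.sum_filter_add_sum_filter_not (B \ Z) fun v => η / 4 * M ≤ deg v]
      push_cast
      refine add_le_add ?_ ?_
      · rw [← nsmul_eq_mul]
        refine Finset.sum_le_card_nsmul _ _ _ fun v _ => ?_
        rw [← hA]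
        exact_mod_cast Finset.card_le_card ((Finset.filter_subset _ _).trans Finset.sdiff_subset)
      · have : (((B \ Z).filter fun v => ¬ η / 4 * M ≤ deg v).card : ℝ) ≤ M := by
          rw [← hB]
          exact_mod_cast Finset.card_le_card ((Finset.filter_subset _ _).trans Finset.sdiff_subset)
        refine le_trans ?_ (mul_le_mul_of_nonneg_right this (by positivity))
        rw [← nsmul_eq_mul]
        refine Finset.sum_le_card_nsmul _ _ _ fun v hv => ?_
        exact (not_le.1 (Finset.mem_filter.1 hv).2).le
    have h4 := (Finset.card_le_card h1).trans (Finset.card_union_le _ _)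
    have h5 := Finset.card_union_le ((Z ∩ A) ×ˢ B) (A ×ˢ (Z ∩ B))
    rw [Finset.card_product, Finset.card_product, hA, hB] at h5
    have h6 : (G.interedges A B).card ≤ c * M + M * c + ∑ v ∈ B \ Z, deg v := by
      rw [← h2]
      have := Nat.mul_le_mul_right M hZA
      have := Nat.mul_le_mul_left M hZB
      omega
    have h7 : ((G.interedges A B).card : ℝ) ≤ c * M + M * c + ((∑ v ∈ B \ Z, deg v : ℕ) : ℝ) := by
      exact_mod_cast h6
    linarith
  have hHq : q ≤ H.card := by
    have h1 : η * (M : ℝ) ^ 2 ≤ c * M + c * M + (H.card * M + M * (η / 4 * M)) := hdense.trans hcount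
    have h2 : (M : ℝ) * (η * M) ≤ M * (2 * c + H.card + η / 4 * M) := by linarith
    have h3 := le_of_mul_le_mul_left h2 hMpos
    have : (q : ℝ) ≤ H.card := by linarith
    exact_mod_cast this
  obtain ⟨Q, hQH, hQ⟩ := Finset.exists_subset_card_eq hHq
  let nb : V → Finset V := fun u => Q.filter fun v => G.Adj u v
  let A' := (A \ Z).filter fun u => k ≤ (nb u).card
  have hAcard : (A \ Z).card ≤ M := hA ▸ Finset.card_le_card Finset.sdiff_subset
  have hA' : 2 ^ q * k < A'.card := by
    have h1 : ∑ v ∈ Q, deg v = ∑ u ∈ A \ Z, (nb u).card := by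
      simp only [deg, nb, Finset.card_filter]
      exact Finset.sum_comm
    have h2 : (q : ℝ) * (η / 4 * M) ≤ ((∑ v ∈ Q, deg v : ℕ) : ℝ) := by
      rw [← hQ, ← nsmul_eq_mul]
      push_cast
      exact Finset.card_nsmul_le_sum _ _ _ fun v hv => (Finset.mem_filter.1 (hQH hv)).2
    have h3 : ∑ u ∈ A \ Z, (nb u).card ≤ A'.card * q + M * k := by
      rw [← Finset.sum_filter_add_sum_filter_not (A \ Z) fun u => k ≤ (nb u).card]
      refine add_le_add ?_ ?_
      · rw [← smul_eq_mul]
        exact Finset.sum_le_card_nsmul _ _ _ fun u _ =>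
          hQ ▸ Finset.card_le_card (Finset.filter_subset _ _)
      · refine le_trans ?_ (Nat.mul_le_mul_right k
          ((Finset.card_filter_le (A \ Z) fun u => ¬ k ≤ (nb u).card).trans hAcard))
        rw [← smul_eq_mul]
        exact Finset.sum_le_card_nsmul _ _ _ fun u hu => (not_le.1 (Finset.mem_filter.1 hu).2).le
    have h4 : (q : ℝ) * (η / 4 * M) ≤ A'.card * q + M * k := by
      rw [h1] at h2
      exact h2.trans (by exact_mod_cast h3)
    have hk' : (1 : ℝ) ≤ k := by exact_mod_cast hk
    have hq0' : (0 : ℝ) < q := pos_of_mul_pos_left (by linarith : (0 : ℝ) < q * η) hη.le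
    -- The choice of `q` makes vertices with fewer than `k` neighbours in `Q` account for at most
    -- half of the edges.
    have h5 : (M : ℝ) * k ≤ q * (η / 8 * M) := by nlinarith
    have h6 : (q : ℝ) * (η / 8 * M) ≤ q * A'.card := by linarith
    have h7 := le_of_mul_le_mul_left h6 hq0'
    have : (2 ^ q * k : ℝ) < A'.card := by linarith
    exact_mod_cast this
  choose! sub hsub hsubk using fun u (hu : u ∈ A') =>
    Finset.exists_subset_card_eq (Finset.mem_filter.1 hu).2
  obtain ⟨S', hS', hfib⟩ := Finset.exists_lt_card_fiber_of_mul_lt_card_of_maps_to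
    (s := A') (t := Q.powerset) (f := sub) (n := k)
    (fun u hu => Finset.mem_powerset.2 ((hsub u hu).trans (Finset.filter_subset _ _)))
    (by rwa [Finset.card_powerset, hQ])
  obtain ⟨S, hS, hSk⟩ := Finset.exists_subset_card_eq hfib.le
  have hSA : ∀ u ∈ S, u ∈ A' ∧ sub u = S' := fun u hu => Finset.mem_filter.1 (hS hu)
  obtain ⟨u₀, hu₀⟩ := Finset.card_pos.1 ((Nat.zero_le k).trans_lt hfib)
  obtain ⟨hu₀A, rfl⟩ := Finset.mem_filter.1 hu₀
  have hAZ : S ⊆ A \ Z := fun u hu => (Finset.mem_filter.1 (hSA u hu).1).1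
  have hBZ : sub u₀ ⊆ B \ Z := fun v hv =>
    (Finset.mem_filter.1 (hQH (Finset.mem_powerset.1 hS' hv))).1
  refine exists_isBridge_of_complete hk hSk (hsubk u₀ hu₀A) (hAZ.trans Finset.sdiff_subset)
    (hBZ.trans Finset.sdiff_subset) hAB (Finset.disjoint_left.2 fun u hu => ?_)
    (Finset.disjoint_left.2 fun u hu => ?_) fun u hu v hv => ?_
  · exact (Finset.mem_sdiff.1 (hAZ hu)).2
  · exact (Finset.mem_sdiff.1 (hBZ hu)).2
  · rw [← (hSA u hu).2] at hv
    exact (Finset.mem_filter.1 (hsub u (hSA u hu).1 hv)).2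

end Bridges

/-! ### Covering by monochromatic cliques. -/

section Tiling

/-- All but boundedly many vertices can be covered by disjoint monochromatic cliques. -/
theorem exists_disjoint_cliques (M : ℕ) (hM : 1 ≤ M) : ∃ R : ℕ, ∀ (V : Type) [Fintype V]
    (C : SimpleGraph V) (j : ℕ), j * M + R ≤ Fintype.card V + M →
    ∃ 𝓕 : Finset (Finset V), 𝓕.card = j ∧
      (∀ t ∈ 𝓕, C.IsNClique M t ∨ Cᶜ.IsNClique M t) ∧
      ∀ s ∈ 𝓕, ∀ t ∈ 𝓕, s ≠ t → Disjoint s t := by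
  classical
  obtain ⟨R, hR⟩ := exists_clique_or_clique_compl M M
  refine ⟨R, fun V _ C j => ?_⟩
  induction j with
  | zero => exact fun _ => ⟨∅, by simp⟩
  | succ j ih =>
    intro hj
    rw [add_mul, one_mul] at hj
    obtain ⟨𝓕, h1, h2, h3⟩ := ih (by omega)
    have hcard : ∀ t ∈ 𝓕, t.card = M := fun t ht => (h2 t ht).elim (·.card_eq) (·.card_eq)
    have hun : (𝓕.biUnion id).card ≤ j * M :=
      h1 ▸ Finset.card_biUnion_le_card_mul _ _ _ fun t ht => (hcard t ht).le
    obtain ⟨t, ht, htC⟩ : ∃ t ⊆ (𝓕.biUnion id)ᶜ, C.IsNClique M t ∨ Cᶜ.IsNClique M t := by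
      rcases hR V C (𝓕.biUnion id)ᶜ (by rw [Finset.card_compl]; omega) with ⟨t, h, h'⟩ | ⟨t, h, h'⟩
      · exact ⟨t, h, Or.inl h'⟩
      · exact ⟨t, h, Or.inr h'⟩
    have hdis : ∀ s ∈ 𝓕, Disjoint t s := fun s hs => Finset.disjoint_left.2 fun u hu hus =>
      Finset.mem_compl.1 (ht hu) (Finset.mem_biUnion.2 ⟨s, hs, hus⟩)
    have htn : t ∉ 𝓕 := by
      intro h
      have h0 := hdis t h
      rw [disjoint_self, Finset.bot_eq_empty] at h0
      have := hcard t h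
      rw [h0, Finset.card_empty] at this
      omega
    refine ⟨insert t 𝓕, by rw [Finset.card_insert_of_notMem htn, h1], ?_, ?_⟩
    · intro s hs
      rcases Finset.mem_insert.1 hs with rfl | hs
      · exact htC
      · exact h2 s hs
    · intro s hs s' hs' hne
      rw [Finset.mem_insert] at hs hs'
      rcases hs with rfl | hs <;> rcases hs' with rfl | hs'
      · exact absurd rfl hne
      · exact hdis s' hs'
      · exact (hdis s hs).symm
      · exact h3 s hs s' hs' hne

end Tiling

/-! ### Merging small classes into large groups. -/

section Grouping

variable {ι κ : Type*}

-- Build up the union of colour classes until its size reaches `m`. Either a single class already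
-- has size between `m` and `l`, or the last step adds fewer than `m` to fewer than `m`, and `2 * m
-- ≤ l`.
open Classical in
theorem exists_colours_card_mem_Icc (c : ι → κ) (U : Finset ι) {l m : ℕ} (hml : 2 * m ≤ l)
    (hc : ∀ x, (U.filter fun u => c u = x).card ≤ l) (S : Finset κ)
    (hS : m ≤ (U.filter fun u => c u ∈ S).card) :
    ∃ S' : Finset κ, m ≤ (U.filter fun u => c u ∈ S').card ∧
      (U.filter fun u => c u ∈ S').card ≤ l := by
  induction S using Finset.induction_on with
  | empty => exact ⟨∅, hS, by simp⟩
  | insert x S _ ih =>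
    by_cases h : m ≤ (U.filter fun u => c u ∈ S).card
    · exact ih h
    by_cases hx : m ≤ (U.filter fun u => c u = x).card
    · exact ⟨{x}, by simpa using hx, by simpa using hc x⟩
    refine ⟨insert x S, hS, ?_⟩
    have : (U.filter fun u => c u ∈ insert x S) =
        (U.filter fun u => c u = x) ∪ U.filter fun u => c u ∈ S := by
      ext u
      simp only [Finset.mem_filter, Finset.mem_insert, Finset.mem_union]
      tauto
    rw [this]
    exact (Finset.card_union_le _ _).trans (by omega)

open Classical in
/-- Colour classes of bounded size can be merged into large groups. -/
theorem exists_groups (c : ι → κ) {l m : ℕ} (hml : 2 * m ≤ l) (r : ℕ) (U : Finset ι)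
    (hc : ∀ x, (U.filter fun u => c u = x).card ≤ l) (hU : r * l + m ≤ U.card) :
    ∃ f : Fin (r + 1) → Finset ι, (∀ i, f i ⊆ U) ∧ (∀ i, m ≤ (f i).card) ∧
      ∀ i j, i ≠ j → ∀ u ∈ f i, ∀ v ∈ f j, c u ≠ c v := by
  induction r generalizing U with
  | zero =>
    refine ⟨fun _ => U, fun _ => Finset.Subset.refl _, fun _ => by simpa using hU, fun i j hij => ?_⟩
    omega
  | succ r ih =>
    rw [add_mul, one_mul] at hU
    obtain ⟨S, hS, hSl⟩ := exists_colours_card_mem_Icc c U hml hc (U.image c) (by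
      rw [Finset.filter_true_of_mem fun u hu => Finset.mem_image_of_mem c hu]; omega)
    have hsplit := Finset.card_filter_add_card_filter_not (s := U) (fun u => c u ∈ S)
    obtain ⟨f, hf1, hf2, hf3⟩ := ih (U.filter fun u => ¬ c u ∈ S)
      (fun x => (Finset.card_le_card (Finset.filter_subset_filter _
        (Finset.filter_subset _ _))).trans (hc x)) (by omega)
    refine ⟨Fin.cons (U.filter fun u => c u ∈ S) f, fun i => ?_, fun i => ?_, fun i j => ?_⟩
    · refine Fin.cases ?_ (fun i => ?_) i
      · exact Finset.filter_subset _ _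
      · exact (hf1 i).trans (Finset.filter_subset _ _)
    · refine Fin.cases ?_ (fun i => ?_) i
      · exact hS
      · exact hf2 i
    · refine Fin.cases ?_ (fun i => ?_) i <;> refine Fin.cases ?_ (fun j => ?_) j
      · exact fun h => absurd rfl h
      · intro _ u hu v hv huv
        exact (Finset.mem_filter.1 (hf1 j hv)).2 (huv ▸ (Finset.mem_filter.1 hu).2)
      · intro _ u hu v hv huv
        exact (Finset.mem_filter.1 (hf1 i hu)).2 (huv ▸ (Finset.mem_filter.1 hv).2)
      · intro hij
        exact hf3 i j fun h => hij (h ▸ rfl)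

end Grouping

/-! ### From a class of blocks without sparse cuts to a cycle power. -/

section Blocks

open Classical in
/-- Two blocks are adjacent when at least `θ` edges run between them. -/
def blockGraph {V ι : Type*} (G : SimpleGraph V) (blk : ι → Finset V) (θ : ℝ) :
    SimpleGraph ι where
  Adj a b := a ≠ b ∧ θ ≤ ((G.interedges (blk a) (blk b)).card : ℝ)
  symm := ⟨fun a b h => ⟨h.1.symm, by
    have : (G.interedges (blk b) (blk a)).card = (G.interedges (blk a) (blk b)).card :=
      haveI : Std.Symm G.Adj := G.symm
      Rel.card_interedges_comm _ _
    rw [this]; exact h.2⟩⟩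
  loopless := ⟨fun _ h => h.1 rfl⟩

open Classical in
/-- A large family of cliques whose block graph has no sparse cut carries a power of a cycle. -/
theorem cyclePower_isContained_of_cutDense {k : ℕ} (hk : 1 ≤ k) {η : ℝ} (hη : 0 < η) :
    ∃ M₁ : ℕ, ∀ M ≥ M₁, ∃ n₁ : ℕ, ∀ n ≥ n₁, ∀ (V ι : Type) [Fintype V] (G : SimpleGraph V)
      (blk : ι → Finset V), Fintype.card V ≤ (2 * k + 4) * n → (∀ a, G.IsNClique M (blk a)) →
      (∀ a b, a ≠ b → Disjoint (blk a) (blk b)) → ∀ X : Finset ι, n ≤ X.card * M →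
      (∀ Y ⊆ X, η * (Y.card * (X \ Y).card) ≤
        (((blockGraph G blk (η * (M : ℝ) ^ 2)).interedges Y (X \ Y)).card : ℝ)) →
      (cyclePower n k).IsContained G := by
  obtain ⟨m, hm⟩ := exists_nat_gt (2 / η)
  rw [div_lt_iff₀ hη] at hm
  have hm1 : 1 ≤ m := by
    by_contra h
    have : m = 0 := by omega
    subst this
    simp at hm
    linarith
  set D := 2 * m with hD
  -- This makes `cap` times the number of deletable blocks, about `η * X.card / 4`, exceed the
  -- length of the whole linking sequence.
  obtain ⟨cap', hcap'⟩ := exists_nat_ge (8 * (k + 2 * k * D) / η)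
  rw [div_le_iff₀ hη] at hcap'
  set cap := cap' + 2 * k * D with hcap
  obtain ⟨M₀, hM₀⟩ := exists_isBridge_of_dense hk (cap + 4 * k * D) hη
  obtain ⟨x₀, hx₀⟩ := exists_nat_ge (8 / η)
  rw [div_le_iff₀ hη] at hx₀
  refine ⟨M₀ + k + 2 * (2 * k * D * (2 * k + 4)), fun M hM => ⟨M * (x₀ + 2) + 2 * k, ?_⟩⟩
  intro n hn V ι _ G blk hV hclq hdis X hX hcut
  have hMpos : 0 < M := by omega
  have hXx : x₀ + 2 ≤ X.card := by
    have : M * (x₀ + 2) ≤ M * X.card := by rw [mul_comm M X.card]; omega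
    exact Nat.le_of_mul_le_mul_left this hMpos
  have hclq' : ∀ a, ∀ u ∈ blk a, ∀ v ∈ blk a, u ≠ v → G.Adj u v :=
    fun a u hu v hv huv => (hclq a).isClique hu hv huv
  have hXM : (X.biUnion blk).card = X.card * M := by
    rw [Finset.card_biUnion fun a _ b _ hab => hdis a b hab,
      Finset.sum_congr rfl fun a _ => (hclq a).card_eq, Finset.sum_const, smul_eq_mul]
  have hXV : X.card * M ≤ (2 * k + 4) * n := hXM ▸ (Finset.card_le_univ _).trans hV
  have hXr : (x₀ : ℝ) ≤ X.card := by exact_mod_cast (by omega : x₀ ≤ X.card)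
  have hXη : 8 ≤ X.card * η := hx₀.trans (mul_le_mul_of_nonneg_right hXr hη.le)
  have hfl : X.card * η / 8 ≤ (⌊η * X.card / 4⌋₊ : ℝ) := by
    have := Nat.lt_floor_add_one (η * X.card / 4)
    linarith
  refine cyclePower_isContained_of_linked (blk := blk) n D cap ⌊η * X.card / 4⌋₊ hk (by omega)
    (blockGraph G blk (η * (M : ℝ) ^ 2)) X hclq' hdis (fun a => by rw [(hclq a).card_eq]; omega)
    ?_ ?_ (by omega) ?_ (by omega) ?_ (hXM ▸ hX)
  · intro a b hab Z hZa hZb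
    exact hM₀ M (by omega) V G _ _ Z (hclq a).card_eq (hclq b).card_eq (hdis a b hab.1) hab.2
      hZa hZb
  · intro W _ hW a ha b hb
    exact exists_walk_of_cutDense _ hη X hcut W
      ((Nat.le_floor_iff (by positivity)).1 hW) m hm a b ha hb
  · have hX1 : (1 : ℝ) ≤ X.card := by exact_mod_cast (by omega : 1 ≤ X.card)
    have h1 : (k : ℝ) + 2 * k * D * X.card ≤ (k + 2 * k * D) * X.card := by
      have : (k : ℝ) * 1 ≤ k * X.card := mul_le_mul_of_nonneg_left hX1 (by positivity)
      linarith
    have h2 : ((k : ℝ) + 2 * k * D) * X.card ≤ X.card * η / 8 * cap' := by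
      have := mul_le_mul_of_nonneg_right hcap' (by positivity : (0 : ℝ) ≤ X.card / 8)
      linarith
    have h3 : X.card * η / 8 * cap' ≤ (⌊η * X.card / 4⌋₊ : ℝ) * cap := by
      refine mul_le_mul hfl ?_ (by positivity) (by positivity)
      exact_mod_cast (by omega : cap' ≤ cap)
    have h4 := h1.trans (h2.trans h3)
    exact_mod_cast h4
  -- Large `M` means few blocks relative to `n`, so the linking sequence takes at most about `n / 2`
  -- terms.
  · have h1 : X.card * (2 * (2 * k * D * (2 * k + 4))) ≤ (2 * k + 4) * n :=
      (Nat.mul_le_mul_left _ (by omega)).trans hXV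
    have h2 : (2 * k + 4) * (2 * (2 * k * D * X.card)) ≤ (2 * k + 4) * n := by
      refine le_trans (le_of_eq ?_) h1
      ring
    have := Nat.le_of_mul_le_mul_left h2 (by omega)
    omega

end Blocks

/-! ### Few missing edges between the groups. -/

section Multipartite

open Classical in
/-- A multipartite graph with few missing edges contains a power of a cycle. -/
theorem cyclePower_isContained_of_few_missing {V : Type*} [Nonempty V] (B : SimpleGraph V)
    (n k d x m : ℕ) (hd : 0 < d) (hn : (k + 2) * (k + 2) ≤ n) (hm : n ≤ (k + 2) * m)
    (U : Fin (k + 2) → Finset V) (hU : ∀ i, m + (k + 1) + 2 * k * d + x < (U i).card)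
    (hdisj : ∀ i j, i ≠ j → Disjoint (U i) (U j)) (E : Finset (V × V))
    (hE : ∀ i j, i ≠ j → ∀ u ∈ U i, ∀ v ∈ U j, ¬ B.Adj u v → (u, v) ∈ E)
    (hEcard : E.card ≤ x * d) : (cyclePower n k).IsContained B := by
  -- At most `x` vertices miss `d` or more edges; discarding them leaves a multipartite graph with
  -- bounded missing degree.
  let bad : Finset V := (E.image Prod.fst).filter fun u => d ≤ (E.filter fun p => p.1 = u).card
  have hbad : bad.card ≤ x := by
    have h1 : ∑ u ∈ bad, (E.filter fun p => p.1 = u).card ≤ E.card := by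
      rw [← Finset.card_biUnion]
      · exact Finset.card_le_card (Finset.biUnion_subset.2 fun u _ => Finset.filter_subset _ _)
      · intro u _ v _ huv
        rw [Function.onFun, Finset.disjoint_left]
        intro p hp hp'
        exact huv ((Finset.mem_filter.1 hp).2.symm.trans (Finset.mem_filter.1 hp').2)
    have h2 : bad.card * d ≤ ∑ u ∈ bad, (E.filter fun p => p.1 = u).card := by
      rw [← smul_eq_mul]
      exact Finset.card_nsmul_le_sum _ _ _ fun u hu => (Finset.mem_filter.1 hu).2
    exact Nat.le_of_mul_le_mul_right (h2.trans (h1.trans hEcard)) hd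
  refine cyclePower_isContained_of_multipartite B n k d m hn hm (fun i => U i \ bad) ?_ ?_ ?_
  · intro i
    have := Finset.le_card_sdiff bad (U i)
    have := hU i
    omega
  · exact fun i j hij => Finset.disjoint_of_subset_left Finset.sdiff_subset
      (Finset.disjoint_of_subset_right Finset.sdiff_subset (hdisj i j hij))
  · intro i j hij u hu
    rw [Finset.mem_sdiff] at hu
    have h1 : ((U j \ bad).filter fun v => ¬ B.Adj u v).card ≤
        (E.filter fun p => p.1 = u).card := by
      refine Finset.card_le_card_of_injOn (fun v => (u, v)) ?_ ?_
      · intro v hv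
        simp only [Finset.coe_filter, Set.mem_ofPred_eq, Finset.mem_sdiff] at hv
        simp only [Finset.coe_filter, Set.mem_ofPred_eq, and_true]
        exact hE i j hij u hu.1 v hv.1.1 hv.2
      · intro v _ w _ h
        exact (Prod.mk.inj h).2
    by_contra h
    refine hu.2 (Finset.mem_filter.2 ⟨?_, by omega⟩)
    obtain ⟨p, hp⟩ := Finset.card_pos.1 (show 0 < (E.filter fun p => p.1 = u).card by omega)
    rw [Finset.mem_filter] at hp
    exact Finset.mem_image.2 ⟨p, hp.1, hp.2⟩

open Classical in
/-- Few edges run between different classes of a partition of the blocks, if few adjacent blocks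
lie in different classes. -/
theorem card_interedges_classes_le {V ι κ : Type*} [Fintype ι] (G : SimpleGraph V)
    (blk : ι → Finset V) {M : ℕ} (hM : ∀ a, (blk a).card = M) {η : ℝ} (hη : 0 ≤ η) (c : ι → κ)
    (hc : (((Finset.univ : Finset (ι × ι)).filter fun p => c p.1 ≠ c p.2 ∧
      (blockGraph G blk (η * (M : ℝ) ^ 2)).Adj p.1 p.2).card : ℝ) ≤
        η * (Fintype.card ι : ℝ) ^ 2) :
    ((((Finset.univ : Finset (ι × ι)).filter fun p => c p.1 ≠ c p.2).biUnion
      fun p => G.interedges (blk p.1) (blk p.2)).card : ℝ) ≤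
        2 * η * ((Fintype.card ι : ℝ) * M) ^ 2 := by
  set F := blockGraph G blk (η * (M : ℝ) ^ 2) with hF
  have h1 : ((((Finset.univ : Finset (ι × ι)).filter fun p => c p.1 ≠ c p.2).biUnion
      fun p => G.interedges (blk p.1) (blk p.2)).card : ℝ) ≤
      ∑ p ∈ (Finset.univ : Finset (ι × ι)).filter (fun p => c p.1 ≠ c p.2),
        ((G.interedges (blk p.1) (blk p.2)).card : ℝ) := by
    exact_mod_cast Finset.card_biUnion_le
  refine h1.trans ?_
  rw [← Finset.sum_filter_add_sum_filter_not _ fun p => F.Adj p.1 p.2, Finset.filter_filter,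
    Finset.filter_filter]
  have h2 : ∑ p ∈ (Finset.univ : Finset (ι × ι)).filter
      (fun p => c p.1 ≠ c p.2 ∧ F.Adj p.1 p.2),
        ((G.interedges (blk p.1) (blk p.2)).card : ℝ) ≤ η * (Fintype.card ι : ℝ) ^ 2 * M ^ 2 := by
    refine le_trans ?_ (mul_le_mul_of_nonneg_right hc (by positivity))
    rw [← nsmul_eq_mul]
    refine Finset.sum_le_card_nsmul _ _ _ fun p _ => ?_
    have := G.card_interedges_le_mul (blk p.1) (blk p.2)
    rw [hM, hM, ← sq] at this
    exact_mod_cast this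
  have h3 : ∑ p ∈ (Finset.univ : Finset (ι × ι)).filter
      (fun p => c p.1 ≠ c p.2 ∧ ¬ F.Adj p.1 p.2),
        ((G.interedges (blk p.1) (blk p.2)).card : ℝ) ≤
      (Fintype.card ι : ℝ) ^ 2 * (η * M ^ 2) := by
    have h4 : (((Finset.univ : Finset (ι × ι)).filter
        (fun p => c p.1 ≠ c p.2 ∧ ¬ F.Adj p.1 p.2)).card : ℝ) ≤ (Fintype.card ι : ℝ) ^ 2 := by
      have := Finset.card_filter_le (Finset.univ : Finset (ι × ι))
        fun p => c p.1 ≠ c p.2 ∧ ¬ F.Adj p.1 p.2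
      rw [Finset.card_univ, Fintype.card_prod, ← sq] at this
      exact_mod_cast this
    refine le_trans ?_ (mul_le_mul_of_nonneg_right h4 (by positivity))
    rw [← nsmul_eq_mul]
    refine Finset.sum_le_card_nsmul _ _ _ fun p hp => ?_
    obtain ⟨hne, hadj⟩ := (Finset.mem_filter.1 hp).2
    by_contra h
    exact hadj ⟨fun h' => hne (h' ▸ rfl), (not_le.1 h).le⟩
  linarith

end Multipartite

/-! ### The dichotomy and the Ramsey bound. -/

section Main

open Classical in
/-- Disjoint cliques of a fixed size that cover enough vertices force a power of a cycle in the graph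
or in its complement. -/
theorem cyclePower_isContained_of_cliques {k : ℕ} (hk : 2 ≤ k) {τ : ℝ} (hτ : 0 < τ)
    (hτ1 : τ ≤ 1 / 12) : ∃ M : ℕ, 1 ≤ M ∧ ∃ n₀ : ℕ, ∀ n ≥ n₀, ∀ (V ι : Type) [Fintype V] [Fintype ι]
      (G : SimpleGraph V) (blk : ι → Finset V), Fintype.card V ≤ (2 * k + 4) * n →
      (∀ a, G.IsNClique M (blk a)) → (∀ a b, a ≠ b → Disjoint (blk a) (blk b)) →
      ((k : ℝ) + 1 + 1 / (k + 2) + τ / 2) * n ≤ Fintype.card ι * M →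
      (cyclePower n k).IsContained G ∨ (cyclePower n k).IsContained Gᶜ := by
  -- `β` makes the greedy losses `(2 * k + 1) * d`, with `d` about `β * n`, cost about `τ * n / 8`.
  -- Then `η` makes the number of red edges between classes at most `(β * n) ^ 2 ≤ d * d`.
  set β : ℝ := τ / (8 * (2 * k + 1)) with hβ
  have hβ0 : 0 < β := by positivity
  set η : ℝ := β ^ 2 / (2 * (2 * k + 4) ^ 2) with hη
  have hη0 : 0 < η := by positivity
  obtain ⟨M₁, hM₁⟩ := cyclePower_isContained_of_cutDense (show 1 ≤ k by omega) hη0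
  obtain ⟨n₁, hn₁⟩ := hM₁ (M₁ + 1) (by omega)
  set M := M₁ + 1 with hM
  obtain ⟨n₂, hn₂⟩ := exists_nat_ge (4 * M * (k + 2) / τ)
  obtain ⟨n₃, hn₃⟩ := exists_nat_gt (8 * (3 * k + 5) / τ)
  refine ⟨M, by omega, n₁ + n₂ + n₃ + 5 * M + (k + 2) * (k + 2), ?_⟩
  intro n hn V ι _ _ G blk hV hclq hdis hL
  have hMpos : (0 : ℝ) < M := by rw [hM]; positivity
  have hn2 : 4 * M * (k + 2) / τ ≤ (n : ℝ) := hn₂.trans (by exact_mod_cast (by omega : n₂ ≤ n))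
  have hn3 : 8 * (3 * k + 5) / τ < (n : ℝ) := hn₃.trans_le (by exact_mod_cast (by omega : n₃ ≤ n))
  have hn5 : 5 * (M : ℝ) ≤ n := by exact_mod_cast (by omega : 5 * M ≤ n)
  have hnsq : (k + 2) * (k + 2) ≤ n := by omega
  have hnpos : (0 : ℝ) < n := by linarith
  rw [div_le_iff₀ hτ] at hn2
  rw [div_lt_iff₀ hτ] at hn3
  have hk2 : (2 : ℝ) ≤ k := by exact_mod_cast hk
  have hinv : 1 / ((k : ℝ) + 2) ≤ 1 / 4 := one_div_le_one_div_of_le (by norm_num) (by linarith)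
  have hinv0 : 0 < 1 / ((k : ℝ) + 2) := by positivity
  set ρ : ℝ := 1 / ((k : ℝ) + 2) with hρ
  set y : ℝ := n / M with hy
  have hyM : y * M = n := div_mul_cancel₀ _ hMpos.ne'
  have hy5 : 5 ≤ y := (le_div_iff₀ hMpos).2 hn5
  have hyτ : 4 * (k + 2) ≤ τ * y := by
    rw [hy, mul_div_assoc', le_div_iff₀ hMpos]
    linarith
  have hLy : ((k : ℝ) + 1 + ρ + τ / 2) * y ≤ Fintype.card ι := by
    rw [hy, mul_div_assoc', div_le_iff₀ hMpos]
    exact hL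
  have hι : Nonempty ι := by
    rw [← Fintype.card_pos_iff]
    have : (0 : ℝ) < Fintype.card ι := lt_of_lt_of_le (by positivity) hLy
    exact_mod_cast this
  obtain ⟨c, hc1, hc2⟩ := exists_cutDense_partition (blockGraph G blk (η * (M : ℝ) ^ 2)) hη0.le
  set l := n / M + 1 with hl
  have hly : y ≤ l := by
    have h1 : n ≤ l * M := by
      have := Nat.lt_div_mul_add (a := n) (b := M) (by omega)
      rw [hl, add_mul, one_mul]; omega
    rw [hy, div_le_iff₀ hMpos]
    exact_mod_cast h1
  have hly' : (l : ℝ) ≤ y + 1 := by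
    rw [hl]; push_cast
    exact add_le_add_left Nat.cast_div_le 1
  by_cases hbig : ∃ x, l ≤ (Finset.univ.filter fun u => c u = x).card
  · left
    obtain ⟨x, hx⟩ := hbig
    refine hn₁ n (by omega) V ι G blk hV hclq hdis (Finset.univ.filter fun u => c u = x) ?_ ?_
    · have h1 : y * M ≤ l * M := mul_le_mul_of_nonneg_right hly hMpos.le
      rw [hyM] at h1
      have h2 : n ≤ l * M := by exact_mod_cast h1
      exact h2.trans (Nat.mul_le_mul_right _ hx)
    · intro Y hY
      exact hc2 x Y _ Finset.disjoint_sdiff (Finset.union_sdiff_of_subset hY)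
  · right
    push Not at hbig
    set m := ⌈(ρ + τ / 4) * y⌉₊ with hm
    have hm1 : (ρ + τ / 4) * y ≤ m := Nat.le_ceil _
    have hm2 : (m : ℝ) < (ρ + τ / 4) * y + 1 := Nat.ceil_lt_add_one (by positivity)
    -- Here `k ≥ 2` and `τ ≤ 1 / 12` enter: `m` is about `(ρ + τ / 4) * y`, and `ρ + τ / 4` is well
    -- below `1 / 2`.
    have hml : 2 * m ≤ l := by
      have h1 : (ρ + τ / 4) * y ≤ (1 / 4 + 1 / 48) * y :=
        mul_le_mul_of_nonneg_right (by linarith) (by linarith)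
      have : (2 : ℝ) * m ≤ l := by linarith
      exact_mod_cast this
    -- Rounding costs at most `k + 2` blocks, covered by the spare `τ * y / 4`.
    have hlm : (k + 1) * l + m ≤ (Finset.univ : Finset ι).card := by
      have h1 : ((k : ℝ) + 1) * l ≤ (k + 1) * (y + 1) :=
        mul_le_mul_of_nonneg_left hly' (by positivity)
      have : ((k : ℝ) + 1) * l + m ≤ Fintype.card ι := by linarith
      rw [Finset.card_univ]
      exact_mod_cast this
    obtain ⟨f, -, hf2, hf3⟩ := exists_groups c hml (k + 1) Finset.univ (fun x => (hbig x).le) hlm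
    have hfdis : ∀ i j, i ≠ j → Disjoint (f i) (f j) := fun i j hij =>
      Finset.disjoint_left.2 fun u hu hu' => hf3 i j hij u hu u hu' rfl
    have hcardU : ∀ i, ((f i).biUnion blk).card = (f i).card * M := fun i => by
      rw [Finset.card_biUnion fun a _ b _ hab => hdis a b hab,
        Finset.sum_congr rfl fun a _ => (hclq a).card_eq, Finset.sum_const, smul_eq_mul]
    have hcardι : Fintype.card ι * M ≤ Fintype.card V := by
      have h1 : (Finset.univ.biUnion blk).card = Fintype.card ι * M := by
        rw [Finset.card_biUnion fun a _ b _ hab => hdis a b hab,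
          Finset.sum_congr rfl fun a _ => (hclq a).card_eq, Finset.sum_const, smul_eq_mul,
          Finset.card_univ]
      exact h1 ▸ Finset.card_le_univ _
    set d := ⌈β * n⌉₊ with hd
    have hd1 : β * n ≤ d := Nat.le_ceil _
    have hd2 : (d : ℝ) < β * n + 1 := Nat.ceil_lt_add_one (by positivity)
    have hdpos : 0 < d := Nat.ceil_pos.2 (by positivity)
    have hV0 : Nonempty V := by
      rw [← Fintype.card_pos_iff]
      have : 0 < Fintype.card ι * M := Nat.mul_pos (Fintype.card_pos_iff.2 hι) (by omega)
      omega
    refine cyclePower_isContained_of_few_missing Gᶜ n k d d (n / (k + 2) + 1) hdpos hnsq ?_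
      (fun i => (f i).biUnion blk) ?_ ?_
      ((Finset.univ.filter fun p : ι × ι => c p.1 ≠ c p.2).biUnion
        fun p => G.interedges (blk p.1) (blk p.2)) ?_ ?_
    · have := Nat.lt_mul_div_succ n (show 0 < k + 2 by omega)
      exact this.le
    · intro i
      have h1 : (ρ + τ / 4) * n ≤ ((f i).biUnion blk).card := by
        rw [hcardU i]
        push_cast
        calc (ρ + τ / 4) * n = (ρ + τ / 4) * y * M := by rw [mul_assoc, hyM]
          _ ≤ m * M := mul_le_mul_of_nonneg_right hm1 hMpos.le
          _ ≤ (f i).card * M :=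
            mul_le_mul_of_nonneg_right (by exact_mod_cast hf2 i) hMpos.le
      have h2 : ((n / (k + 2) : ℕ) : ℝ) ≤ ρ * n := by
        refine Nat.cast_div_le.trans (le_of_eq ?_)
        push_cast
        rw [hρ]; ring
      have h3 : (2 * (k : ℝ) + 1) * d ≤ (2 * k + 1) * (β * n + 1) :=
        mul_le_mul_of_nonneg_left hd2.le (by positivity)
      have h4 : (2 * (k : ℝ) + 1) * (β * n) = τ * n / 8 := by
        rw [hβ]; field_simp
      have h5 : (((n / (k + 2) : ℕ) : ℝ) + 1) + (k + 1) + 2 * k * d + d <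
          ((f i).biUnion blk).card := by linarith
      exact_mod_cast h5
    · intro i j hij
      rw [Finset.disjoint_biUnion_left]
      intro a ha
      rw [Finset.disjoint_biUnion_right]
      intro b hb
      refine hdis a b fun hab => ?_
      exact Finset.disjoint_left.1 (hfdis i j hij) ha (hab ▸ hb)
    · intro i j hij u hu v hv huv
      obtain ⟨a, ha, hua⟩ := Finset.mem_biUnion.1 hu
      obtain ⟨b, hb, hvb⟩ := Finset.mem_biUnion.1 hv
      have hcab := hf3 i j hij a ha b hb
      have huv' : u ≠ v := by
        rintro rfl
        exact Finset.disjoint_left.1 (hdis a b fun h => hcab (h ▸ rfl)) hua hvb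
      refine Finset.mem_biUnion.2 ⟨(a, b), Finset.mem_filter.2 ⟨Finset.mem_univ _, hcab⟩, ?_⟩
      rw [SimpleGraph.compl_adj, not_and, not_not] at huv
      exact (SimpleGraph.mem_interedges_iff _).2 ⟨hua, hvb, huv huv'⟩
    · have h1 := card_interedges_classes_le G blk (fun a => (hclq a).card_eq) hη0.le c hc1
      have h2 : (Fintype.card ι : ℝ) * M ≤ (2 * k + 4) * n := by
        exact_mod_cast hcardι.trans hV
      have h3 : 2 * η * ((Fintype.card ι : ℝ) * M) ^ 2 ≤ 2 * η * ((2 * k + 4) * n) ^ 2 := by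
        gcongr
      have h4 : 2 * η * (((2 * k + 4) * n) ^ 2 : ℝ) = (β * n) * (β * n) := by
        rw [hη]; field_simp
      have h5 : (β * n) * (β * n) ≤ (d : ℝ) * d := mul_le_mul hd1 hd1 (by positivity) (by positivity)
      have h6 := h1.trans (h3.trans (h4.le.trans h5))
      exact_mod_cast h6

theorem exists_isRamsey_cyclePower {k : ℕ} (hk : 2 ≤ k) : ∃ n₀ : ℕ, ∀ n ≥ n₀,
    IsRamsey (cyclePower n k) (cyclePower n k) ⌊(2 * (k : ℝ) + 2 + 2 / (k + 1)) * n⌋₊ := by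
  classical
  have hk2 : (2 : ℝ) ≤ k := by exact_mod_cast hk
  -- `τ` is exactly the gap between `1 / (k + 1)` and `1 / (k + 2)`. Half of it absorbs the
  -- uncovered vertices, and the other half is the slack in the dichotomy.
  set τ : ℝ := 1 / ((k + 1) * (k + 2)) with hτ
  have hτ0 : 0 < τ := by positivity
  have hτ1 : τ ≤ 1 / 12 := one_div_le_one_div_of_le (by norm_num) (by nlinarith)
  have hsplit : 1 / ((k : ℝ) + 1) = 1 / (k + 2) + τ := by rw [hτ]; field_simp; ring
  obtain ⟨M, hM, n₀, hn₀⟩ := cyclePower_isContained_of_cliques hk hτ0 hτ1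
  obtain ⟨R, hR⟩ := exists_disjoint_cliques M hM
  obtain ⟨n₁, hn₁⟩ := exists_nat_ge ((R + 1) / τ)
  refine ⟨n₀ + n₁, fun n hn => ?_⟩
  have hn1 : (R + 1) / τ ≤ (n : ℝ) := hn₁.trans (by exact_mod_cast (by omega : n₁ ≤ n))
  rw [div_le_iff₀ hτ0] at hn1
  set N := ⌊(2 * (k : ℝ) + 2 + 2 / (k + 1)) * n⌋₊ with hN
  intro C
  have hNle : (N : ℝ) ≤ (2 * (k : ℝ) + 2 + 2 / (k + 1)) * n := Nat.floor_le (by positivity)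
  have hNlt : (2 * (k : ℝ) + 2 + 2 / (k + 1)) * n < N + 1 := Nat.lt_floor_add_one _
  have hdiv : 2 / ((k : ℝ) + 1) = 2 * (1 / (k + 2) + τ) := by rw [← hsplit]; ring
  have hdiv1 : 2 / ((k : ℝ) + 1) ≤ 2 := (div_le_iff₀ (by positivity)).2 (by linarith)
  have hNn : Fintype.card (Fin N) ≤ (2 * k + 4) * n := by
    rw [Fintype.card_fin]
    have : (N : ℝ) ≤ (2 * k + 4) * n :=
      hNle.trans (mul_le_mul_of_nonneg_right (by linarith) (by positivity))
    exact_mod_cast this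
  have hNR : R ≤ N := by
    have h1 : (n : ℝ) * τ ≤ n * 1 := mul_le_mul_of_nonneg_left (by linarith) (by positivity)
    have h2 : 1 * (n : ℝ) ≤ (2 * (k : ℝ) + 2 + 2 / (k + 1)) * n :=
      mul_le_mul_of_nonneg_right (by have : 0 ≤ 2 / ((k : ℝ) + 1) := by positivity
                                     linarith) (by positivity)
    have : (R : ℝ) ≤ N := by linarith
    exact_mod_cast this
  -- The largest number of cliques the tiling allows; fewer than `R` vertices remain uncovered.
  set j := (N + M - R) / M with hj
  obtain ⟨𝓕, h1, h2, h3⟩ := hR (Fin N) C j (by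
    rw [Fintype.card_fin]
    have : j * M ≤ N + M - R := Nat.div_mul_le_self (N + M - R) M
    omega)
  have hjM : N ≤ j * M + R := by
    have : N + M - R < j * M + M := Nat.lt_div_mul_add (by omega)
    omega
  -- Stated for either colour, so that the majority colour can be treated as red.
  have key : ∀ (G : SimpleGraph (Fin N)) (𝓡 : Finset (Finset (Fin N))), 𝓡 ⊆ 𝓕 →
      (∀ t ∈ 𝓡, G.IsNClique M t) → j ≤ 2 * 𝓡.card →
      (cyclePower n k).IsContained G ∨ (cyclePower n k).IsContained Gᶜ := by
    intro G 𝓡 hsub hclq hcard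
    refine hn₀ n (by omega) (Fin N) 𝓡 G (fun t => t.1) hNn (fun t => hclq t.1 t.2)
      (fun s t hst => h3 _ (hsub s.2) _ (hsub t.2) fun h => hst (Subtype.ext h)) ?_
    rw [Fintype.card_coe]
    have h4 : N ≤ 2 * (𝓡.card * M) + R := by
      have := Nat.mul_le_mul_right M hcard
      rw [mul_assoc] at this
      omega
    have h5 : (N : ℝ) ≤ 2 * (𝓡.card * M) + R := by exact_mod_cast h4
    rw [hdiv] at hNlt
    linarith
  have hsum := Finset.card_filter_add_card_filter_not (s := 𝓕) (fun t => C.IsNClique M t)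
  rcases le_or_gt j (2 * (𝓕.filter fun t => C.IsNClique M t).card) with h | h
  · exact key C _ (Finset.filter_subset _ _) (fun t ht => (Finset.mem_filter.1 ht).2) h
  · have := key Cᶜ (𝓕.filter fun t => ¬ C.IsNClique M t) (Finset.filter_subset _ _)
      (fun t ht => (h2 t (Finset.mem_filter.1 ht).1).resolve_left (Finset.mem_filter.1 ht).2)
      (by omega)
    rwa [compl_compl, or_comm] at this

theorem ramseyNumber_cyclePower_le {k : ℕ} (hk : 2 ≤ k) : ∃ n₀ : ℕ, ∀ n ≥ n₀,
    (ramseyNumber (cyclePower n k) (cyclePower n k) : ℝ) ≤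
      (2 * (k : ℝ) + 2 + 2 / (k + 1)) * n := by
  obtain ⟨n₀, hn₀⟩ := exists_isRamsey_cyclePower hk
  refine ⟨n₀, fun n hn => ?_⟩
  have h1 := (isLeast_ramseyNumber (cyclePower n k) (cyclePower n k)).2 (hn₀ n hn)
  exact (Nat.cast_le.2 h1).trans (Nat.floor_le (by positivity))

theorem ramseyNumber_mono {V : Type*} [Finite V] {G H : SimpleGraph V} (h : G ≤ H) :
    ramseyNumber G G ≤ ramseyNumber H H := by
  refine (isLeast_ramseyNumber G G).2 fun C => ?_
  have hGH : G.IsContained H := SimpleGraph.IsContained.of_le h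
  exact ((isLeast_ramseyNumber H H).1 C).imp hGH.trans hGH.trans

theorem exists_isLittleO_of_eventually_le {a b : ℕ → ℝ} {n₀ : ℕ} (h : ∀ n ≥ n₀, a n ≤ b n) :
    ∃ f : ℕ → ℝ, f =o[atTop] (fun n : ℕ => (n : ℝ)) ∧ ∀ n, a n ≤ b n + f n := by
  refine ⟨fun n => if n₀ ≤ n then 0 else a n - b n, ?_, fun n => ?_⟩
  · refine (isLittleO_zero (fun n : ℕ => (n : ℝ)) atTop).congr' ?_ EventuallyEq.rfl
    filter_upwards [eventually_ge_atTop n₀] with n hn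
    rw [if_pos hn]
  · simp only
    split_ifs with hn
    · linarith [h n hn]
    · linarith

end Main

theorem mainTheorem5 (k : ℕ) (hk : 2 ≤ k) :
    (∃ f : ℕ → ℝ, f =o[atTop] (fun n : ℕ => (n : ℝ)) ∧
      ∀ n : ℕ, 1 ≤ n →
        (ramseyNumber (pathPower n k) (pathPower n k) : ℝ) ≤
          (2 * (k : ℝ) + 2 + 2 / ((k : ℝ) + 1)) * (n : ℝ) + f n) ∧
    (∃ g : ℕ → ℝ, g =o[atTop] (fun n : ℕ => (n : ℝ)) ∧
      ∀ n : ℕ, 3 ≤ n →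
        (ramseyNumber (cyclePower n k) (cyclePower n k) : ℝ) ≤
          (2 * (chi (cyclePower n k) : ℝ) + 2 / (chi (cyclePower n k) : ℝ)) * (n : ℝ) + g n) := by
  obtain ⟨n₀, hn₀⟩ := ramseyNumber_cyclePower_le hk
  constructor
  · obtain ⟨f, hf, hf'⟩ := exists_isLittleO_of_eventually_le
      (a := fun n => (ramseyNumber (pathPower n k) (pathPower n k) : ℝ)) (n₀ := n₀)
      fun n hn => (Nat.cast_le.2 (ramseyNumber_mono (pathPower_le_cyclePower n k))).trans (hn₀ n hn)
    exact ⟨f, hf, fun n _ => hf' n⟩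
  · obtain ⟨g, hg, hg'⟩ := exists_isLittleO_of_eventually_le
      (a := fun n => (ramseyNumber (cyclePower n k) (cyclePower n k) : ℝ))
      (b := fun n => (2 * (chi (cyclePower n k) : ℝ) + 2 / (chi (cyclePower n k) : ℝ)) * (n : ℝ))
      (n₀ := n₀ + k + 1) fun n hn => by
        refine (hn₀ n (by omega)).trans (mul_le_mul_of_nonneg_right ?_ (by positivity))
        have hchi : (k : ℝ) + 1 ≤ chi (cyclePower n k) := by
          exact_mod_cast add_one_le_chi_cyclePower (show k + 1 ≤ n by omega)
        set x : ℝ := (chi (cyclePower n k) : ℝ)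
        have h1 : (0 : ℝ) < k + 1 := by positivity
        have h2 : 0 < x := by linarith
        -- Monotonicity of `2 * x + 2 / x` beyond `k + 1`: the loss in the second term is at most
        -- the gain in the first.
        have h3 : 2 / ((k : ℝ) + 1) - 2 / x = 2 * (x - (k + 1)) / ((k + 1) * x) := by
          field_simp
        have h4 : 2 * (x - (k + 1)) / ((k + 1) * x) ≤ 2 * (x - (k + 1)) := by
          refine div_le_self (by linarith) ?_
          have hk1 : (1 : ℝ) ≤ k + 1 := by linarith [(Nat.cast_nonneg k : (0 : ℝ) ≤ k)]
          exact one_le_mul_of_one_le_of_one_le hk1 (hk1.trans hchi)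
        linarith
    exact ⟨g, hg, fun n _ => hg' n⟩
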